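/- For a finite graph $G$, let $\delta(G)$ be its minimum degree, and let $r_g(G,\mathcal{H})$, the global resilience of $G$ with respect to Hamiltonicity, be the minimal number $m$ for which there is a subgraph $H\subseteq G$ with exactly $m$ edges such that $G\setminus H$ (the graph obtained from $G$ by deleting the edges of $H$) is not Hamiltonian. Let $p=p(n)\in[0,1]$ satisfy $np-\log n-\log\log n\to\infty$ as $n\to\infty$ (natural logarithms), and let $G\sim G(n,p)$ be the binomial random graph on $n$ vertices, in which each pair of vertices is an edge independently with probability $p$. Then $$\lim_{n\to\infty}\mathbb{P}\bigl(r_g(G,\mathcal{H})=\delta(G)-1\bigr)=1 .$$ -/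

import Mathlib

open Filter Topology

/-- The global resilience `r_g(G, P)` of a graph `G` with respect to a graph property `P`: the
minimal number `m` of edges of a subgraph `H ⊆ G` such that `G \ H` (same vertices, the edges of
`H` deleted) does not satisfy `P`. The minimum is over a non-empty set as soon as the edgeless
graph fails `P`, see `globalResilience_mem`. -/
noncomputable def globalResilience {V : Type*} (P : SimpleGraph V → Prop) (G : SimpleGraph V) : ℕ :=
  sInf {m : ℕ | ∃ H : SimpleGraph V, H ≤ G ∧ H.edgeSet.ncard = m ∧ ¬ P (G \ H)}

/-- If the edgeless graph does not satisfy `P`, the minimum in `globalResilience` is attained. -/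
theorem globalResilience_mem {V : Type*} (P : SimpleGraph V → Prop) (G : SimpleGraph V)
    (hP : ¬ P ⊥) :
    ∃ H : SimpleGraph V, H ≤ G ∧ H.edgeSet.ncard = globalResilience P G ∧ ¬ P (G \ H) :=
  Nat.sInf_mem (s := {m : ℕ | ∃ H : SimpleGraph V, H ≤ G ∧ H.edgeSet.ncard = m ∧ ¬ P (G \ H)})
    ⟨G.edgeSet.ncard, G, le_rfl, rfl, by rwa [sdiff_self]⟩

/-! Upper bound: delete all edges but one at a vertex of minimum degree. The surviving edge is then
a bridge, which no Hamiltonian graph has (`exists_le_not_isHamiltonian`).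

Lower bound: let `H` have at most `δ(G) - 2` edges, so `G \ H` keeps minimum degree at least 2. The
proof is Pósa's rotation-extension argument run inside a sparse subgraph `Γ` of `G \ H`. In a
connected non-Hamiltonian graph where all sets of at most `n / 4` vertices expand by a factor 2,
rotating a longest path at both ends yields at least `n ^ 2 / 32` boosters, that is, missing pairs
whose addition creates a Hamiltonian cycle or lengthens a longest path (`sq_card_le_boosters`). With
high probability every sparse `Γ ≤ G` with that many boosters has more than `k` of them among the
edges of `G`, for some `k ≥ δ(G)`. The set `H` therefore cannot contain them all, and adding
surviving boosters one at a time ends in a Hamiltonian cycle (`isHamiltonian_of_expander`).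

Sparseness of `Γ` is what makes the union bound over all candidates affordable
(`binomialRandom_real_not_hasBoosters_le`). So `Γ` consists of `m` edges at each vertex, where `m`
is a small multiple of `np`, together with the edges lying in a fixed sparse template `T`. Small
sets expand because small sets span few edges and low-degree vertices are far apart; large sets
expand because `G ⊓ T` joins any two of them by more than `k` edges. `ResilienceWitness` collects
these properties, and `isHamiltonian_sdiff` draws the deterministic conclusion. The rest is Chernoff
and union bounds showing that a witness exists with high probability. -/

namespace SimpleGraph

/-! ### Pósa rotations of a longest path. -/

section Rotation

variable {V : Type*}

/-- The list `L` enumerates the vertices of a path of `G`. -/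
def IsPathList (G : SimpleGraph V) (L : List V) : Prop := L.IsChain G.Adj ∧ L.Nodup

/-- The lists obtained from `L₀` by Pósa rotations that fix the first vertex. -/
inductive PosaRotation (G : SimpleGraph V) (L₀ : List V) : List V → Prop
  | refl : PosaRotation G L₀ L₀
  | step (A : List V) (y z x : V) (B : List V) :
      PosaRotation G L₀ (A ++ y :: z :: B) → (z :: B).getLast? = some x → G.Adj y x →
      PosaRotation G L₀ (A ++ y :: (z :: B).reverse)

theorem getLast?_rotate (A : List V) (y z : V) (B : List V) :
    (A ++ y :: (z :: B).reverse).getLast? = some z := by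
  rw [List.reverse_cons, ← List.cons_append, ← List.append_assoc, List.getLast?_concat]

theorem isChain_rotate {r : V → V → Prop} (hr : ∀ a b, r a b → r b a) {A : List V} {y z x : V}
    {B : List V} (h : (A ++ y :: z :: B).IsChain r) (hx : (z :: B).getLast? = some x)
    (hyx : r y x) : (A ++ y :: (z :: B).reverse).IsChain r := by
  rw [List.isChain_split, List.isChain_cons] at h ⊢
  refine ⟨h.1, ?_, ?_⟩
  · intro w hw
    rw [List.head?_reverse, hx] at hw
    cases hw
    exact hyx
  · rw [List.isChain_reverse]
    exact h.2.2.imp fun a b hab => hr _ _ hab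

theorem PosaRotation.isChain {G : SimpleGraph V} {L₀ L : List V} (h : PosaRotation G L₀ L)
    (h₀ : L₀.IsChain G.Adj) : L.IsChain G.Adj := by
  induction h with
  | refl => exact h₀
  | step A y z x B _ hx hyx ih => exact isChain_rotate (fun _ _ h => h.symm) ih hx hyx

theorem PosaRotation.perm {G : SimpleGraph V} {L₀ L : List V} (h : PosaRotation G L₀ L) :
    L.Perm L₀ := by
  induction h with
  | refl => rfl
  | step A y z x B _ hx hyx ih =>
    exact (List.Perm.append_left A ((List.reverse_perm _).cons y)).trans ih

theorem PosaRotation.head? {G : SimpleGraph V} {L₀ L : List V} (h : PosaRotation G L₀ L) :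
    L.head? = L₀.head? := by
  induction h with
  | refl => rfl
  | step A y z x B _ hx hyx ih => rw [← ih]; cases A <;> simp

section

variable [DecidableEq V]

/-- Consecutive vertices of a list, in either order. -/
def ListNbr (L : List V) (a b : V) : Prop :=
  a ∈ L ∧ b ∈ L ∧ (L.idxOf b = L.idxOf a + 1 ∨ L.idxOf a = L.idxOf b + 1)

theorem isChain_listNbr {L : List V} (hL : L.Nodup) (y : V) :
    L.IsChain fun a b => (a = y → ListNbr L y b) ∧ (b = y → ListNbr L y a) := by
  rw [List.isChain_iff_getElem]
  intro i hi
  have h1 := hL.idxOf_getElem i (by omega)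
  have h2 := hL.idxOf_getElem (i + 1) hi
  constructor
  · rintro rfl
    exact ⟨List.getElem_mem _, List.getElem_mem _, Or.inl (by omega)⟩
  · rintro rfl
    exact ⟨List.getElem_mem _, List.getElem_mem _, Or.inr (by omega)⟩

end

variable [Fintype V] [DecidableEq V]

open scoped Classical in
/-- The neighbours of the set `S` outside `S`. -/
noncomputable def extNbrs (G : SimpleGraph V) (S : Finset V) : Finset V :=
  Finset.univ.filter fun v => v ∉ S ∧ ∃ u ∈ S, G.Adj u v

theorem mem_extNbrs {G : SimpleGraph V} {S : Finset V} {v : V} :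
    v ∈ G.extNbrs S ↔ v ∉ S ∧ ∃ u ∈ S, G.Adj u v := by
  simp [extNbrs]

/-- Pósa's rotation lemma: the set of ends of the rotations of a longest path is poorly
expanding. -/
theorem exists_rotation_ends {G : SimpleGraph V} {L : List V} (hL : G.IsPathList L)
    (hmax : ∀ L', G.IsPathList L' → L'.length ≤ L.length) (hne : L ≠ []) :
    ∃ R : Finset V, R.Nonempty ∧
      (∀ r ∈ R, ∃ L', G.IsPathList L' ∧ L'.head? = L.head? ∧ L'.length = L.length ∧
        L'.getLast? = some r) ∧
      (G.extNbrs R).card < 2 * R.card := by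
  classical
  set R : Finset V := Finset.univ.filter fun r => ∃ L', PosaRotation G L L' ∧ L'.getLast? = some r
    with hR
  have memR : ∀ {r}, r ∈ R ↔ ∃ L', PosaRotation G L L' ∧ L'.getLast? = some r := by simp [hR]
  have hpath : ∀ {L'}, PosaRotation G L L' → G.IsPathList L' := fun h =>
    ⟨h.isChain hL.1, h.perm.nodup_iff.2 hL.2⟩
  have hlast : L.getLast hne ∈ R := memR.2 ⟨L, .refl, List.getLast?_eq_some_getLast hne⟩
  refine ⟨R, ⟨_, hlast⟩, ?_, ?_⟩
  · intro r hr
    obtain ⟨L', h, h'⟩ := memR.1 hr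
    exact ⟨L', hpath h, h.head?, h.perm.length_eq, h'⟩
  -- Heart of the lemma: an outside neighbour of `R` must be next to a member of `R` on the original
  -- path `L`.
  have key : ∀ y ∈ G.extNbrs R, ∃ r ∈ R, ListNbr L y r := by
    intro y hy
    by_contra! hcon
    rw [mem_extNbrs] at hy
    obtain ⟨hyR, x, hxR, hxy⟩ := hy
    -- As long as no `L`-neighbour of `y` becomes an end, no rotation gives `y` a new neighbour on
    -- the path: a rotation replaces the link `y'z` by `y'x` with both `z` and `x` in `R`, so it
    -- cannot involve `y`.
    have inv : ∀ {L'}, PosaRotation G L L' →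
        L'.IsChain fun a b => (a = y → ListNbr L y b) ∧ (b = y → ListNbr L y a) := by
      intro L' h
      induction h with
      | refl => exact isChain_listNbr hL.2 y
      | step A y' z x B h' hx hyx ih =>
        have hzR : z ∈ R := memR.2 ⟨_, .step A y' z x B h' hx hyx, getLast?_rotate _ _ z B⟩
        have hxR : x ∈ R := memR.2 ⟨_, h', by simpa using hx⟩
        refine isChain_rotate (fun a b h => ⟨h.2, h.1⟩) ih hx ⟨?_, ?_⟩
        · rintro rfl
          rw [List.isChain_split, List.isChain_cons] at ih
          exact absurd ((ih.2.1 z (by simp)).1 rfl) (hcon z hzR)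
        · rintro rfl
          exact absurd hxR hyR
    obtain ⟨L', hrot, hx⟩ := memR.1 hxR
    -- Maximality enters here: a neighbour of the end `x` off the path would extend it.
    have hyL' : y ∈ L' := by
      by_contra hyn
      have : G.IsPathList (L' ++ [y]) := by
        refine ⟨List.isChain_append.2 ⟨(hpath hrot).1, by simp, ?_⟩, ?_⟩
        · intro a ha b hb
          rw [hx] at ha
          simp at ha hb
          subst ha hb
          exact hxy
        · rw [List.nodup_append]
          refine ⟨(hpath hrot).2, by simp, ?_⟩
          intro a ha b hb
          simp at hb
          subst hb
          rintro rfl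
          exact hyn ha
      have h1 := hmax _ this
      rw [List.length_append, hrot.perm.length_eq] at h1
      simp at h1
    obtain ⟨A, C, rfl⟩ := List.append_of_mem hyL'
    cases C with
    | nil =>
      simp at hx
      exact hyR (hx ▸ hxR)
    | cons z B =>
      have hzR : z ∈ R := memR.2 ⟨_, .step A y z x B hrot (by simpa using hx) hxy.symm,
        getLast?_rotate _ _ z B⟩
      have := inv hrot
      rw [List.isChain_split, List.isChain_cons] at this
      exact hcon z hzR ((this.2.1 z (by simp)).1 rfl)
  -- Outside neighbours are predecessors or successors on `L` of members of `R`. The last vertex of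
  -- `L` is in `R` and has no successor, which makes the final inequality strict.
  have hsub : G.extNbrs R ⊆ R.image (fun r => L.getD (L.idxOf r - 1) r) ∪
      (R.erase (L.getLast hne)).image (fun r => L.getD (L.idxOf r + 1) r) := by
    intro y hy
    obtain ⟨r, hr, hyL, hrL, h⟩ := key y hy
    have hyi := List.idxOf_lt_length_of_mem hyL
    have hri := List.idxOf_lt_length_of_mem hrL
    rw [Finset.mem_union, Finset.mem_image, Finset.mem_image]
    rcases h with h | h
    · left
      refine ⟨r, hr, ?_⟩
      rw [h, Nat.add_sub_cancel, List.getD_eq_getElem _ _ hyi]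
      exact List.getElem_idxOf hyi
    · right
      refine ⟨r, ?_, ?_⟩
      · rw [Finset.mem_erase]
        refine ⟨?_, hr⟩
        rintro rfl
        rw [List.getLast_eq_getElem, hL.2.idxOf_getElem] at h
        omega
      · rw [← h, List.getD_eq_getElem _ _ hyi]
        exact List.getElem_idxOf hyi
  have hpos : 0 < R.card := Finset.card_pos.2 ⟨_, hlast⟩
  calc (G.extNbrs R).card ≤ _ := Finset.card_le_card hsub
    _ ≤ R.card + (R.erase (L.getLast hne)).card :=
        (Finset.card_union_le _ _).trans (add_le_add Finset.card_image_le Finset.card_image_le)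
    _ < 2 * R.card := by rw [Finset.card_erase_of_mem hlast]; omega

end Rotation

/-! ### Longest paths and boosters. -/

section Boosters

variable {V : Type*}

theorem IsPathList.mono {G H : SimpleGraph V} (h : G ≤ H) {L : List V} (hL : G.IsPathList L) :
    H.IsPathList L :=
  ⟨hL.1.imp fun _ _ hab => h hab, hL.2⟩

theorem IsPathList.reverse {G : SimpleGraph V} {L : List V} (hL : G.IsPathList L) :
    G.IsPathList L.reverse :=
  ⟨List.isChain_reverse.2 (hL.1.imp fun _ _ h => h.symm), List.nodup_reverse.2 hL.2⟩

variable [Fintype V]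

open scoped Classical in
/-- The number of vertices of a longest path. -/
noncomputable def pathNumber (G : SimpleGraph V) : ℕ :=
  Nat.findGreatest (fun k => ∃ L, G.IsPathList L ∧ L.length = k) (Fintype.card V)

theorem pathNumber_le (G : SimpleGraph V) : G.pathNumber ≤ Fintype.card V := by
  classical
  exact Nat.findGreatest_le _

theorem IsPathList.length_le {G : SimpleGraph V} {L : List V} (hL : G.IsPathList L) :
    L.length ≤ G.pathNumber := by
  classical
  exact Nat.le_findGreatest hL.2.length_le_card ⟨L, hL, rfl⟩

theorem exists_isPathList_length (G : SimpleGraph V) :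
    ∃ L, G.IsPathList L ∧ L.length = G.pathNumber := by
  classical
  exact Nat.findGreatest_spec (P := fun k => ∃ L, G.IsPathList L ∧ L.length = k)
    (Nat.zero_le _) ⟨[], ⟨List.IsChain.nil, List.nodup_nil⟩, rfl⟩

variable [DecidableEq V]

theorem isHamiltonian_of_isPathList {G : SimpleGraph V} {L : List V} (hL : G.IsPathList L)
    (hV : ∀ v, v ∈ L) (h3 : 3 ≤ Fintype.card V) {a b : V} (ha : L.head? = some a)
    (hb : L.getLast? = some b) (hab : G.Adj a b) : G.IsHamiltonian := by
  intro _
  have hne : L ≠ [] := by rintro rfl; simp at ha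
  have ha' : L.head hne = a := by
    rw [List.head?_eq_some_head hne] at ha; exact Option.some.inj ha
  have hb' : L.getLast hne = b := by
    rw [List.getLast?_eq_some_getLast hne] at hb; exact Option.some.inj hb
  have hlen : L.length = Fintype.card V := by
    rw [← List.toFinset_card_of_nodup hL.2, ← Finset.card_univ]
    congr 1
    ext v
    simp [hV]
  let q := Walk.ofSupport L hne hL.1
  have hq : q.IsPath := by
    rw [Walk.isPath_def, Walk.support_ofSupport]; exact hL.2
  have hql : q.length = L.length - 1 := Walk.length_ofSupport hne hL.1
  have hadj : G.Adj (L.getLast hne) (L.head hne) := by rw [ha', hb']; exact hab.symm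
  refine ⟨_, Walk.cons hadj q, ?_⟩
  rw [Walk.isHamiltonianCycle_iff_isCycle_and_length_eq, Walk.cons_isCycle_iff]
  refine ⟨⟨hq, fun hmem => ?_⟩, ?_⟩
  · have := hq.length_eq_one_of_mem_edges (Sym2.eq_swap ▸ hmem)
    omega
  · rw [Walk.length_cons]; omega

/-- A path whose ends are adjacent can be closed to a Hamiltonian cycle or prolonged. -/
theorem isHamiltonian_or_exists_longer {G : SimpleGraph V} (hG : G.Connected) {L : List V}
    (hL : G.IsPathList L) (h3 : 3 ≤ Fintype.card V) {a b : V} (ha : L.head? = some a)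
    (hb : L.getLast? = some b) (hab : G.Adj a b) :
    G.IsHamiltonian ∨ ∃ L', G.IsPathList L' ∧ L'.length = L.length + 1 := by
  by_cases hV : ∀ v, v ∈ L
  · exact Or.inl (isHamiltonian_of_isPathList hL hV h3 ha hb hab)
  right
  push Not at hV
  obtain ⟨w, hw⟩ := hV
  have haL : a ∈ L := List.mem_of_mem_head? ha
  obtain ⟨q, -⟩ := hG.exists_isPath a w
  obtain ⟨d, -, hd1, hd2⟩ := q.exists_boundary_dart {v | v ∈ L} haL hw
  have hd := d.adj
  simp only [Set.mem_ofPred_eq] at hd1 hd2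
  generalize d.toProd.1 = v at *
  generalize d.toProd.2 = u at *
  obtain ⟨A, B, rfl⟩ := List.append_of_mem hd1
  -- The path closed by the edge `ab` is a cycle; it is cut open just before `v`, which has a
  -- neighbour `u` off the cycle.
  refine ⟨u :: (v :: B ++ A), ⟨?_, ?_⟩, ?_⟩
  · have hch := hL.1
    rw [List.isChain_append] at hch
    rw [List.isChain_cons, List.isChain_append]
    refine ⟨?_, hch.2.1, hch.1, ?_⟩
    · intro y hy
      simp at hy
      subst hy
      exact hd.symm
    · intro x hx y hy
      have hx' : (A ++ v :: B).getLast? = some x := by simpa using hx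
      have hy' : (A ++ v :: B).head? = some y := by
        cases A with
        | nil => simp at hy
        | cons c A => simpa using hy
      rw [hb] at hx'
      rw [ha] at hy'
      cases hx'
      cases hy'
      exact hab.symm
  · rw [List.nodup_cons]
    have hp : (v :: B ++ A).Perm (A ++ v :: B) := List.perm_append_comm
    exact ⟨fun h => hd2 (hp.mem_iff.1 h), hp.nodup_iff.2 hL.2⟩
  · simp
    omega

open scoped Classical in
/-- The missing edges whose addition creates a Hamiltonian cycle or a longer path. -/
noncomputable def boosters (G : SimpleGraph V) : Finset (Sym2 V) :=
  Finset.univ.filter fun e => ¬ e.IsDiag ∧ e ∉ G.edgeSet ∧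
    ((G ⊔ fromEdgeSet {e}).IsHamiltonian ∨ G.pathNumber < (G ⊔ fromEdgeSet {e}).pathNumber)

theorem mem_boosters {G : SimpleGraph V} {e : Sym2 V} :
    e ∈ G.boosters ↔ ¬ e.IsDiag ∧ e ∉ G.edgeSet ∧
      ((G ⊔ fromEdgeSet {e}).IsHamiltonian ∨
        G.pathNumber < (G ⊔ fromEdgeSet {e}).pathNumber) := by
  simp [boosters]

/-- Closing a longest path in a connected graph gives a Hamiltonian cycle or a longer path. Hence
its ends cannot already be adjacent, and joining them is progress. -/
theorem mem_boosters_of_isPathList {G : SimpleGraph V} (hG : G.Connected)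
    (hH : ¬ G.IsHamiltonian) (h3 : 3 ≤ Fintype.card V) {L : List V} (hL : G.IsPathList L)
    (hlen : L.length = G.pathNumber) {a b : V} (ha : L.head? = some a)
    (hb : L.getLast? = some b) : s(a, b) ∈ G.boosters := by
  have hne : a ≠ b := by
    rintro rfl
    have hl1 : L.length = 1 := by
      cases L with
      | nil => simp at ha
      | cons c L =>
        simp at ha
        subst ha
        cases L with
        | nil => rfl
        | cons d L =>
          rw [List.getLast?_cons_cons] at hb
          exact absurd (List.mem_of_mem_getLast? hb) (List.nodup_cons.1 hL.2).1
    have : Nontrivial V := Fintype.one_lt_card_iff_nontrivial.1 (by omega)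
    obtain ⟨w, hw⟩ := hG.preconnected.exists_adj_of_nontrivial a
    have : G.IsPathList [a, w] := ⟨by simpa using hw, by simpa using hw.ne⟩
    have := this.length_le
    rw [← hlen, hl1] at this
    simp at this
  rw [mem_boosters]
  refine ⟨by simpa using hne, ?_, ?_⟩
  · intro hadj
    rcases isHamiltonian_or_exists_longer hG hL h3 ha hb hadj with h | ⟨L', h, h'⟩
    · exact hH h
    · have := h.length_le
      omega
  · have hle : G ≤ G ⊔ fromEdgeSet {s(a, b)} := le_sup_left
    rcases isHamiltonian_or_exists_longer (hG.mono hle) (hL.mono hle) h3 ha hb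
      (by simp [hne]) with h | ⟨L', h, h'⟩
    · exact Or.inl h
    · have := h.length_le
      exact Or.inr (by omega)

/-- A connected non-Hamiltonian expander has many boosters. -/
theorem sq_card_le_boosters {G : SimpleGraph V} (hG : G.Connected) (hH : ¬ G.IsHamiltonian)
    (h3 : 3 ≤ Fintype.card V)
    (hexp : ∀ S : Finset V, 4 * S.card ≤ Fintype.card V → 2 * S.card ≤ (G.extNbrs S).card) :
    Fintype.card V ^ 2 ≤ 32 * G.boosters.card := by
  obtain ⟨L, hL, hlen⟩ := G.exists_isPathList_length
  have main : ∀ L, G.IsPathList L → L.length = G.pathNumber → ∃ R : Finset V,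
      Fintype.card V < 4 * R.card ∧ ∀ r ∈ R, ∃ L', G.IsPathList L' ∧ L'.head? = L.head? ∧
        L'.length = G.pathNumber ∧ L'.getLast? = some r := by
    intro L hL hlen
    have hne : L ≠ [] := by
      rintro rfl
      have : Nonempty V := hG.nonempty
      have : G.IsPathList [Classical.arbitrary V] := ⟨by simp, by simp⟩
      have := this.length_le
      rw [← hlen] at this
      simp at this
    obtain ⟨R, -, h1, h2⟩ := exists_rotation_ends hL (fun L' h => hlen ▸ h.length_le) hne
    refine ⟨R, ?_, fun r hr => by simpa only [hlen] using h1 r hr⟩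
    by_contra! hcon
    have := hexp R hcon
    omega
  obtain ⟨R, hRc, hR⟩ := main L hL hlen
  have hex : ∀ r : V, ∃ R' : Finset V, r ∈ R → (Fintype.card V < 4 * R'.card ∧
      ∀ r' ∈ R', s(r, r') ∈ G.boosters) := by
    intro r
    by_cases hr : r ∈ R
    · obtain ⟨L', h1, h2, h3', h4⟩ := hR r hr
      -- Reversal makes `r` the fixed first vertex, so a second round of rotations varies the other
      -- end.
      obtain ⟨R', h5, h6⟩ := main L'.reverse h1.reverse (by simpa using h3')
      refine ⟨R', fun _ => ⟨h5, fun r' hr' => ?_⟩⟩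
      obtain ⟨L'', h7, h8, h9, h10⟩ := h6 r' hr'
      exact mem_boosters_of_isPathList hG hH h3 h7 h9 (by rw [h8, List.head?_reverse, h4]) h10
    · exact ⟨∅, fun h => absurd h hr⟩
  choose R' hR' using hex
  have hsub : (R.sigma R').image (fun x => s(x.1, x.2)) ⊆ G.boosters := by
    intro e he
    obtain ⟨⟨r, r'⟩, hx, rfl⟩ := Finset.mem_image.1 he
    rw [Finset.mem_sigma] at hx
    exact (hR' r hx.1).2 r' hx.2
  -- More than `n / 4` choices for each end give over `n ^ 2 / 16` ordered pairs; forgetting the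
  -- order costs a factor 2.
  have hfib : (R.sigma R').card ≤ 2 * ((R.sigma R').image (fun x => s(x.1, x.2))).card := by
    refine Finset.card_le_mul_card_image _ 2 fun e _ => ?_
    induction e with
    | h a b =>
      calc _ ≤ ({⟨a, b⟩, ⟨b, a⟩} : Finset (Σ _ : V, V)).card := by
            refine Finset.card_le_card fun x hx => ?_
            obtain ⟨c, d⟩ := x
            simp only [Finset.mem_filter, Sym2.eq_iff] at hx
            rcases hx.2 with ⟨rfl, rfl⟩ | ⟨rfl, rfl⟩ <;> simp
        _ ≤ 2 := Finset.card_le_two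
  have hcard : Fintype.card V * R.card ≤ 4 * (R.sigma R').card := by
    rw [Finset.card_sigma, Finset.mul_sum, mul_comm, ← smul_eq_mul]
    exact Finset.card_nsmul_le_sum _ _ _ fun r hr => (hR' r hr).1.le
  have := Finset.card_le_card hsub
  nlinarith

end Boosters

/-! ### Expansion of small sets. -/

section Sparse

variable {V : Type*}

/-- The vertices of `B` are pairwise far apart in `G` and not on short cycles. -/
structure Scattered (G : SimpleGraph V) (B : Finset V) : Prop where
  not_adj : ∀ a ∈ B, ∀ b ∈ B, ¬ G.Adj a b
  eq_of_adj : ∀ a ∈ B, ∀ b ∈ B, ∀ x, G.Adj a x → G.Adj b x → a = b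
  subsingleton : ∀ v ∉ B, ∀ a ∈ B, ∀ b ∈ B, ∀ x y, (x = a ∨ G.Adj a x) → (y = b ∨ G.Adj b y) →
    G.Adj v x → G.Adj v y → x = y

theorem Scattered.mono {G Γ : SimpleGraph V} {B : Finset V} (h : G.Scattered B) (hΓ : Γ ≤ G) :
    Γ.Scattered B where
  not_adj a ha b hb hab := h.not_adj a ha b hb (hΓ hab)
  eq_of_adj a ha b hb x hax hbx := h.eq_of_adj a ha b hb x (hΓ hax) (hΓ hbx)
  subsingleton v hv a ha b hb x y hx hy hvx hvy :=
    h.subsingleton v hv a ha b hb x y (hx.imp_right (@hΓ _ _)) (hy.imp_right (@hΓ _ _))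
      (hΓ hvx) (hΓ hvy)

variable [Fintype V]

open scoped Classical in
/-- The edges of `G` as a finset. -/
noncomputable def edges (G : SimpleGraph V) : Finset (Sym2 V) :=
  Finset.univ.filter fun e => e ∈ G.edgeSet

open scoped Classical in
/-- The neighbours of `v` as a finset. -/
noncomputable def nbrs (G : SimpleGraph V) (v : V) : Finset V :=
  Finset.univ.filter fun w => G.Adj v w

theorem mem_edges {G : SimpleGraph V} {e : Sym2 V} : e ∈ G.edges ↔ e ∈ G.edgeSet := by
  simp [edges]

theorem mk_mem_edges {G : SimpleGraph V} {a b : V} : s(a, b) ∈ G.edges ↔ G.Adj a b := by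
  simp [edges]

theorem mem_nbrs {G : SimpleGraph V} {v w : V} : w ∈ G.nbrs v ↔ G.Adj v w := by
  simp [nbrs]

theorem edges_mono {G H : SimpleGraph V} (h : G ≤ H) : G.edges ⊆ H.edges := fun _ he =>
  mem_edges.2 (edgeSet_mono h (mem_edges.1 he))

theorem card_edges (G : SimpleGraph V) : G.edges.card = G.edgeSet.ncard := by
  rw [← Set.ncard_coe_finset]
  congr 1
  ext e
  simp [mem_edges]

variable [DecidableEq V]

/-- The pairs with one element in `X` and the other in `Y`. -/
def crossPairs (X Y : Finset V) : Finset (Sym2 V) := (X ×ˢ Y).image fun q => s(q.1, q.2)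

theorem card_nbrs_eq (G : SimpleGraph V) (v : V) :
    (G.nbrs v).card = ((G.nbrs v).image fun w => s(v, w)).card := by
  rw [Finset.card_image_of_injective]
  exact fun a b h => Sym2.congr_right.1 h

theorem image_nbrs_subset_edges (G : SimpleGraph V) (v : V) :
    ((G.nbrs v).image fun w => s(v, w)) ⊆ G.edges := by
  intro e he
  obtain ⟨w, hw, rfl⟩ := Finset.mem_image.1 he
  exact mk_mem_edges.2 (mem_nbrs.1 hw)

theorem card_nbrs_le_card_edges (G : SimpleGraph V) (v : V) :
    (G.nbrs v).card ≤ G.edges.card := by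
  rw [card_nbrs_eq]
  exact Finset.card_le_card (G.image_nbrs_subset_edges v)

theorem card_nbrs_add_card_nbrs_le (G : SimpleGraph V) {u v : V} (huv : u ≠ v) :
    (G.nbrs u).card + (G.nbrs v).card ≤ G.edges.card + 1 := by
  rw [card_nbrs_eq, card_nbrs_eq, ← Finset.card_union_add_card_inter]
  refine add_le_add (Finset.card_le_card (Finset.union_subset (G.image_nbrs_subset_edges u)
    (G.image_nbrs_subset_edges v))) ?_
  calc _ ≤ ({s(u, v)} : Finset (Sym2 V)).card := by
        refine Finset.card_le_card fun e he => ?_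
        rw [Finset.mem_inter, Finset.mem_image, Finset.mem_image] at he
        obtain ⟨⟨a, -, rfl⟩, ⟨b, -, hb⟩⟩ := he
        rw [Sym2.eq_iff] at hb
        rcases hb with ⟨h1, -⟩ | ⟨h1, h2⟩
        · exact absurd h1.symm huv
        · subst h1; simp
    _ = 1 := by simp

theorem card_nbrs_le_add (G H : SimpleGraph V) (v : V) :
    (G.nbrs v).card ≤ ((G \ H).nbrs v).card + (H.nbrs v).card := by
  refine (Finset.card_le_card fun w hw => ?_).trans (Finset.card_union_le _ _)
  rw [mem_nbrs] at hw
  rw [Finset.mem_union, mem_nbrs, mem_nbrs, sdiff_adj]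
  tauto

theorem sum_card_nbrs_le (G : SimpleGraph V) {S U : Finset V} (hSU : S ⊆ U)
    (hU : ∀ v ∈ S, G.nbrs v ⊆ U) :
    ∑ v ∈ S, (G.nbrs v).card ≤ 2 * (G.edges ∩ U.sym2).card := by
  rw [← Finset.card_sigma]
  have hsub : (S.sigma G.nbrs).image (fun x => s(x.1, x.2)) ⊆ G.edges ∩ U.sym2 := by
    intro e he
    obtain ⟨⟨a, b⟩, hx, rfl⟩ := Finset.mem_image.1 he
    rw [Finset.mem_sigma] at hx
    rw [Finset.mem_inter, mk_mem_edges, Finset.mk_mem_sym2_iff]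
    exact ⟨mem_nbrs.1 hx.2, hSU hx.1, hU _ hx.1 hx.2⟩
  have hfib : (S.sigma G.nbrs).card ≤
      2 * ((S.sigma G.nbrs).image (fun x => s(x.1, x.2))).card := by
    refine Finset.card_le_mul_card_image _ 2 fun e _ => ?_
    induction e with
    | h a b =>
      calc _ ≤ ({⟨a, b⟩, ⟨b, a⟩} : Finset (Σ _ : V, V)).card := by
            refine Finset.card_le_card fun x hx => ?_
            obtain ⟨c, d⟩ := x
            simp only [Finset.mem_filter, Sym2.eq_iff] at hx
            rcases hx.2 with ⟨rfl, rfl⟩ | ⟨rfl, rfl⟩ <;> simp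
        _ ≤ 2 := Finset.card_le_two
  exact hfib.trans (Nat.mul_le_mul_left 2 (Finset.card_le_card hsub))

/-- Small sets span few edges: at most `m / 12` per vertex. -/
def LocallySparse (G : SimpleGraph V) (m s : ℕ) : Prop :=
  ∀ U : Finset V, U.Nonempty → U.card ≤ 6 * s → 12 * (G.edges ∩ U.sym2).card < m * U.card

/-- Otherwise `S` with its neighbours has at most `6 * S.card` vertices and spans fewer than `m *
S.card / 2` edges, whereas the degrees in `S` sum to at least `m * S.card`. -/
theorem LocallySparse.five_mul_card_le {G Γ : SimpleGraph V} {m s : ℕ} (hG : G.LocallySparse m s)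
    (hΓ : Γ ≤ G) {S : Finset V} (hs : S.card ≤ s) (hm : ∀ v ∈ S, m ≤ (Γ.nbrs v).card) :
    5 * S.card ≤ (Γ.extNbrs S).card := by
  by_contra! hcon
  have hne : S.Nonempty := by
    rw [Finset.nonempty_iff_ne_empty]
    rintro rfl
    simp at hcon
  have hU : (S ∪ Γ.extNbrs S).card ≤ 6 * S.card :=
    (Finset.card_union_le _ _).trans (by omega)
  have h1 := hG _ (hne.mono Finset.subset_union_left) (hU.trans (Nat.mul_le_mul_left 6 hs))
  have h2 : ∑ v ∈ S, (Γ.nbrs v).card ≤ 2 * (Γ.edges ∩ (S ∪ Γ.extNbrs S).sym2).card := by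
    refine sum_card_nbrs_le Γ Finset.subset_union_left fun v hv w hw => ?_
    rw [Finset.mem_union, mem_extNbrs]
    by_cases hwS : w ∈ S
    · exact Or.inl hwS
    · exact Or.inr ⟨hwS, v, hv, mem_nbrs.1 hw⟩
  have h3 : S.card * m ≤ ∑ v ∈ S, (Γ.nbrs v).card := by
    rw [← smul_eq_mul]
    exact Finset.card_nsmul_le_sum _ _ _ hm
  have h4 : (Γ.edges ∩ (S ∪ Γ.extNbrs S).sym2).card ≤
      (G.edges ∩ (S ∪ Γ.extNbrs S).sym2).card :=
    Finset.card_le_card (Finset.inter_subset_inter_right (edges_mono hΓ))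
  have h5 : m * (S ∪ Γ.extNbrs S).card ≤ m * (6 * S.card) := Nat.mul_le_mul_left m hU
  nlinarith

/-- Write `S₁ = S ∩ B` and `S₂ = S \ B`. The neighbourhoods of `S₁` are disjoint and lose at most
`S₂.card` vertices to `S₂`; of the `5 * S₂.card` outside neighbours of `S₂`, at most `S₂.card` meet
`S₁` or its neighbourhood. The total is at least `2 * S₁.card + 3 * S₂.card`. -/
theorem Scattered.two_mul_card_le {G : SimpleGraph V} {B S : Finset V} (hB : G.Scattered B)
    (h2 : ∀ v ∈ B, 2 ≤ (G.nbrs v).card)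
    (h5 : 5 * (S \ B).card ≤ (G.extNbrs (S \ B)).card) :
    2 * S.card ≤ (G.extNbrs S).card := by
  set S₁ := S ∩ B with hS₁
  set S₂ := S \ B with hS₂
  have hmem₁ : ∀ {v}, v ∈ S₁ ↔ v ∈ S ∧ v ∈ B := Finset.mem_inter
  have hmem₂ : ∀ {v}, v ∈ S₂ ↔ v ∈ S ∧ v ∉ B := Finset.mem_sdiff
  have hcard : S.card = S₁.card + S₂.card := (Finset.card_inter_add_card_sdiff S B).symm
  set N := S₁.biUnion G.nbrs with hN
  have hmemN : ∀ {w}, w ∈ N ↔ ∃ v ∈ S₁, G.Adj v w := by simp [hN, mem_nbrs]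
  have hNcard : 2 * S₁.card ≤ N.card := by
    rw [hN, Finset.card_biUnion, mul_comm, ← smul_eq_mul]
    · exact Finset.card_nsmul_le_sum _ _ _ fun v hv => h2 v (hmem₁.1 hv).2
    · intro a ha b hb hab
      rw [Function.onFun, Finset.disjoint_left]
      intro x hx hx'
      exact hab (hB.eq_of_adj a (hmem₁.1 ha).2 b (hmem₁.1 hb).2 x (mem_nbrs.1 hx)
        (mem_nbrs.1 hx'))
  -- Each vertex of `S₂` has at most one neighbour in `B` or adjacent to `B`.
  have hE : (G.extNbrs S₂ ∩ (S₁ ∪ N)).card ≤ S₂.card := by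
    refine Finset.card_le_card_of_forall_subsingleton (fun w v => G.Adj v w) ?_ ?_
    · intro w hw
      exact (mem_extNbrs.1 (Finset.mem_inter.1 hw).1).2
    · intro v hv x hx y hy
      obtain ⟨hx1, hx2⟩ := hx
      obtain ⟨hy1, hy2⟩ := hy
      have aux : ∀ {x}, x ∈ G.extNbrs S₂ ∩ (S₁ ∪ N) → ∃ a ∈ B, x = a ∨ G.Adj a x := by
        intro x hx
        rcases Finset.mem_union.1 (Finset.mem_inter.1 hx).2 with h | h
        · exact ⟨x, (hmem₁.1 h).2, Or.inl rfl⟩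
        · obtain ⟨a, ha, hax⟩ := hmemN.1 h
          exact ⟨a, (hmem₁.1 ha).2, Or.inr hax⟩
      obtain ⟨a, ha, hax⟩ := aux hx1
      obtain ⟨b, hb, hby⟩ := aux hy1
      exact hB.subsingleton v (hmem₂.1 hv).2 a ha b hb x y hax hby hx2 hy2
  have hsub : (N \ S₂) ∪ (G.extNbrs S₂ \ (S₁ ∪ N)) ⊆ G.extNbrs S := by
    intro w hw
    rw [mem_extNbrs]
    rcases Finset.mem_union.1 hw with h | h
    · obtain ⟨h1, h1'⟩ := Finset.mem_sdiff.1 h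
      obtain ⟨a, ha, haw⟩ := hmemN.1 h1
      refine ⟨fun hwS => ?_, a, (hmem₁.1 ha).1, haw⟩
      by_cases hwB : w ∈ B
      · exact hB.not_adj a (hmem₁.1 ha).2 w hwB haw
      · exact h1' (hmem₂.2 ⟨hwS, hwB⟩)
    · obtain ⟨h1, h1'⟩ := Finset.mem_sdiff.1 h
      obtain ⟨h3, v, hv, hvw⟩ := mem_extNbrs.1 h1
      refine ⟨fun hwS => ?_, v, (hmem₂.1 hv).1, hvw⟩
      rw [Finset.mem_union, not_or] at h1'
      by_cases hwB : w ∈ B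
      · exact h1'.1 (hmem₁.2 ⟨hwS, hwB⟩)
      · exact h3 (hmem₂.2 ⟨hwS, hwB⟩)
  have hdisj : Disjoint (N \ S₂) (G.extNbrs S₂ \ (S₁ ∪ N)) := by
    rw [Finset.disjoint_left]
    intro w hw hw'
    exact (Finset.mem_sdiff.1 hw').2 (Finset.mem_union_right _ (Finset.mem_sdiff.1 hw).1)
  have h3 := Finset.card_le_card hsub
  rw [Finset.card_union_of_disjoint hdisj] at h3
  have h4 := Finset.le_card_sdiff S₂ N
  have h6 := Finset.card_inter_add_card_sdiff (G.extNbrs S₂) (S₁ ∪ N)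
  omega

/-- A single exceptional vertex needs no scattering: if `S \ B` is non-empty, then `5 * (S \ B).card
- 1` already suffices. -/
theorem two_mul_card_le_of_card_le_one {G : SimpleGraph V} {B S : Finset V} (hB : B.card ≤ 1)
    (h2 : ∀ v ∈ B, 2 ≤ (G.nbrs v).card)
    (h5 : 5 * (S \ B).card ≤ (G.extNbrs (S \ B)).card) :
    2 * S.card ≤ (G.extNbrs S).card := by
  have hcard : S.card = (S ∩ B).card + (S \ B).card := (Finset.card_inter_add_card_sdiff S B).symm
  have hle : (S ∩ B).card ≤ 1 := (Finset.card_le_card Finset.inter_subset_right).trans hB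
  rcases Nat.eq_zero_or_pos (S \ B).card with h0 | hpos
  · rw [Finset.card_eq_zero, Finset.sdiff_eq_empty_iff_subset] at h0
    rcases Nat.eq_zero_or_pos S.card with h | h
    · omega
    have hS1 : S.card = 1 := le_antisymm ((Finset.card_le_card h0).trans hB) h
    obtain ⟨v, rfl⟩ := Finset.card_eq_one.1 hS1
    have hv : v ∈ B := h0 (Finset.mem_singleton_self v)
    refine (h2 v hv).trans (Finset.card_le_card fun w hw => ?_)
    rw [mem_nbrs] at hw
    rw [mem_extNbrs]
    exact ⟨by simpa using hw.ne', v, by simp, hw⟩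
  · have hsub : G.extNbrs (S \ B) \ (S ∩ B) ⊆ G.extNbrs S := by
      intro w hw
      obtain ⟨h1, h1'⟩ := Finset.mem_sdiff.1 hw
      obtain ⟨h3, v, hv, hvw⟩ := mem_extNbrs.1 h1
      rw [mem_extNbrs]
      refine ⟨fun hwS => ?_, v, (Finset.mem_sdiff.1 hv).1, hvw⟩
      by_cases hwB : w ∈ B
      · exact h1' (Finset.mem_inter.2 ⟨hwS, hwB⟩)
      · exact h3 (Finset.mem_sdiff.2 ⟨hwS, hwB⟩)
    have h3 := Finset.card_le_card hsub
    have h4 := Finset.le_card_sdiff (S ∩ B) (G.extNbrs (S \ B))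
    omega

theorem card_edges_inter_insert (G : SimpleGraph V) {U N : Finset V} {x : V} (hx : x ∉ U)
    (hN : N ⊆ U) (hadj : ∀ u ∈ N, G.Adj x u) :
    (G.edges ∩ U.sym2).card + N.card ≤ (G.edges ∩ (insert x U).sym2).card := by
  have hinj : (N.image fun w => s(x, w)).card = N.card :=
    Finset.card_image_of_injective _ fun a b h => Sym2.congr_right.1 h
  rw [← hinj, ← Finset.card_union_of_disjoint]
  · refine Finset.card_le_card (Finset.union_subset (Finset.inter_subset_inter_left
      (Finset.sym2_mono (Finset.subset_insert x U))) fun e he => ?_)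
    obtain ⟨w, hw, rfl⟩ := Finset.mem_image.1 he
    rw [Finset.mem_inter, mk_mem_edges, Finset.mk_mem_sym2_iff]
    exact ⟨hadj w hw, Finset.mem_insert_self _ _, Finset.mem_insert_of_mem (hN hw)⟩
  · rw [Finset.disjoint_left]
    intro e he he'
    obtain ⟨w, hw, rfl⟩ := Finset.mem_image.1 he'
    rw [Finset.mem_inter, Finset.mk_mem_sym2_iff] at he
    exact hx he.2.1

/-- Attaching vertices one by one preserves the edge count of a connected graph. Allowing `x = u` or
`x ∈ U` lets degenerate configurations pass without case distinctions. -/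
theorem card_insert_le_edges_add_one (G : SimpleGraph V) {U : Finset V} {x u : V} (hu : u ∈ U)
    (hxu : x = u ∨ G.Adj u x) (hU : U.card ≤ (G.edges ∩ U.sym2).card + 1) :
    (insert x U).card ≤ (G.edges ∩ (insert x U).sym2).card + 1 := by
  by_cases hx : x ∈ U
  · rwa [Finset.insert_eq_of_mem hx]
  have hadj : G.Adj x u := by
    rcases hxu with rfl | h
    · exact absurd hu hx
    · exact h.symm
  have := G.card_edges_inter_insert (N := {u}) hx (by simpa using hu) (by simpa using hadj)
  rw [Finset.card_insert_of_notMem hx]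
  rw [Finset.card_singleton] at this
  omega

theorem card_insert_le_edges (G : SimpleGraph V) {U : Finset V} {x u w : V} (hx : x ∉ U)
    (hu : u ∈ U) (hw : w ∈ U) (huw : u ≠ w) (hxu : G.Adj x u) (hxw : G.Adj x w)
    (hU : U.card ≤ (G.edges ∩ U.sym2).card + 1) :
    (insert x U).card ≤ (G.edges ∩ (insert x U).sym2).card := by
  have := G.card_edges_inter_insert (N := {u, w}) hx (by
    intro y hy; simp at hy; rcases hy with rfl | rfl <;> assumption) (by
    intro y hy; simp at hy; rcases hy with rfl | rfl <;> assumption)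
  rw [Finset.card_insert_of_notMem hx]
  rw [Finset.card_pair huw] at this
  omega

/-- No set of at most five vertices that contains vertices of degree less than `k` spans
many edges. -/
def LowDegreeScattered (G : SimpleGraph V) (k : ℕ) : Prop :=
  ∀ U A : Finset V, A ⊆ U → U.card ≤ 5 → A.Nonempty → A.card ≤ 2 →
    (∀ a ∈ A, (G.nbrs a).card < k) → (G.edges ∩ U.sym2).card + A.card ≤ U.card

/-- On at most five vertices the hypothesis forbids a connected set with two low-degree vertices
(`two`) and a connected set with a cycle and one low-degree vertex (`one`). Any violation of
scattering produces one of these; the largest consists of `v`, `x`, `y` and two members of `B`. -/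
theorem LowDegreeScattered.scattered {G : SimpleGraph V} {k : ℕ} (h : G.LowDegreeScattered k)
    {B : Finset V} (hB : ∀ a ∈ B, (G.nbrs a).card < k) : G.Scattered B := by
  have two : ∀ a ∈ B, ∀ b ∈ B, a ≠ b → ∀ U : Finset V, a ∈ U → b ∈ U → U.card ≤ 5 →
      ¬ U.card ≤ (G.edges ∩ U.sym2).card + 1 := by
    intro a ha b hb hab U haU hbU h5 hU
    have := h U {a, b} (by
      intro y hy; simp at hy; rcases hy with rfl | rfl <;> assumption) h5 (by simp)
      Finset.card_le_two (by
      intro y hy; simp at hy; rcases hy with rfl | rfl <;> exact hB _ (by assumption))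
    rw [Finset.card_pair hab] at this
    omega
  have one : ∀ a ∈ B, ∀ U : Finset V, a ∈ U → U.card ≤ 5 →
      ¬ U.card ≤ (G.edges ∩ U.sym2).card := by
    intro a ha U haU h5 hU
    have := h U {a} (by simpa using haU) h5 (by simp) (by simp) (by simpa using hB a ha)
    rw [Finset.card_singleton] at this
    omega
  have start : ∀ v : V, ({v} : Finset V).card ≤ (G.edges ∩ ({v} : Finset V).sym2).card + 1 := by
    intro v; simp
  constructor
  · intro a ha b hb hab
    exact two a ha b hb hab.ne {b, a} (by simp) (by simp)
      (Finset.card_le_two.trans (by norm_num))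
      (G.card_insert_le_edges_add_one (by simp) (Or.inr hab) (start a))
  · intro a ha b hb x hax hbx
    by_contra hab
    exact two a ha b hb hab {b, x, a} (by simp) (by simp)
      (Finset.card_le_three.trans (by norm_num))
      (G.card_insert_le_edges_add_one (u := x) (by simp) (Or.inr hbx.symm)
        (G.card_insert_le_edges_add_one (u := a) (by simp) (Or.inr hax) (start a)))
  · intro v hv a ha b hb x y hx hy hvx hvy
    by_contra hxy
    have h3 := G.card_insert_le_edges_add_one (x := y) (U := {x, v}) (u := v) (by simp)
      (Or.inr hvy) (G.card_insert_le_edges_add_one (u := v) (by simp) (Or.inr hvx) (start v))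
    by_cases hab : a = b
    · subst hab
      have hav : a ≠ v := by rintro rfl; exact hv ha
      by_cases hxa : x = a
      · subst hxa
        have hay : G.Adj x y := hy.resolve_left (Ne.symm hxy)
        refine one x ha {y, x, v} (by simp) (Finset.card_le_three.trans (by norm_num)) ?_
        exact G.card_insert_le_edges (u := x) (w := v) (by simp [hvy.ne', Ne.symm hxy]) (by simp)
          (by simp) hav hay.symm hvy.symm
          (G.card_insert_le_edges_add_one (u := v) (by simp) (Or.inr hvx) (start v))
      · have hax : G.Adj a x := hx.resolve_left hxa
        by_cases hya : y = a
        · subst hya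
          refine one y ha {x, y, v} (by simp) (Finset.card_le_three.trans (by norm_num)) ?_
          exact G.card_insert_le_edges (u := y) (w := v) (by simp [hvx.ne', hxy]) (by simp)
            (by simp) hav hax.symm hvx.symm
            (G.card_insert_le_edges_add_one (u := v) (by simp) (Or.inr hvy) (start v))
        · have hay : G.Adj a y := hy.resolve_left hya
          refine one a ha {a, y, x, v} (by simp) (Finset.card_le_four.trans (by norm_num)) ?_
          exact G.card_insert_le_edges (u := x) (w := y) (by simp [Ne.symm hxa, Ne.symm hya, hav])
            (by simp) (by simp) hxy hax hay h3
    · refine two a ha b hb hab {b, a, y, x, v} (by simp) (by simp) Finset.card_le_five ?_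
      exact G.card_insert_le_edges_add_one (u := y) (by simp)
        (hy.imp Eq.symm Adj.symm)
        (G.card_insert_le_edges_add_one (u := x) (by simp) (hx.imp Eq.symm Adj.symm) h3)

end Sparse

/-! ### The deterministic resilience argument. -/

section Resilience

variable {V : Type*} [Fintype V]

open scoped Classical in
/-- A set of `m` neighbours of `v`, or all of them if there are fewer. -/
noncomputable def someNbrs (G : SimpleGraph V) (m : ℕ) (v : V) : Finset V :=
  (Finset.exists_subset_card_eq (Nat.min_le_right m (G.nbrs v).card)).choose

theorem someNbrs_subset (G : SimpleGraph V) (m : ℕ) (v : V) : G.someNbrs m v ⊆ G.nbrs v :=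
  (Finset.exists_subset_card_eq (Nat.min_le_right m (G.nbrs v).card)).choose_spec.1

theorem card_someNbrs (G : SimpleGraph V) (m : ℕ) (v : V) :
    (G.someNbrs m v).card = min m (G.nbrs v).card :=
  (Finset.exists_subset_card_eq (Nat.min_le_right m (G.nbrs v).card)).choose_spec.2

/-- The edges of `G` in the template `T`, together with `m` edges of `G` at each vertex. -/
def skeleton (G T : SimpleGraph V) (m : ℕ) : SimpleGraph V where
  Adj a b := G.Adj a b ∧ (T.Adj a b ∨ b ∈ G.someNbrs m a ∨ a ∈ G.someNbrs m b)
  symm := ⟨fun a b h => ⟨h.1.symm, by have := h.2; rw [T.adj_comm]; tauto⟩⟩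
  loopless := ⟨fun a h => h.1.ne rfl⟩

theorem skeleton_le (G T : SimpleGraph V) (m : ℕ) : G.skeleton T m ≤ G := fun _ _ h => h.1

theorem inf_le_skeleton (G T : SimpleGraph V) (m : ℕ) : G ⊓ T ≤ G.skeleton T m :=
  fun _ _ h => ⟨h.1, Or.inl h.2⟩

theorem min_le_card_nbrs_skeleton (G T : SimpleGraph V) (m : ℕ) (v : V) :
    min m (G.nbrs v).card ≤ ((G.skeleton T m).nbrs v).card := by
  rw [← card_someNbrs]
  refine Finset.card_le_card fun w hw => mem_nbrs.2 ⟨?_, Or.inr (Or.inl hw)⟩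
  exact mem_nbrs.1 (G.someNbrs_subset m v hw)

variable [DecidableEq V]

theorem card_edges_skeleton_le (G T : SimpleGraph V) (m : ℕ) :
    (G.skeleton T m).edges.card ≤ (G ⊓ T).edges.card + Fintype.card V * m := by
  have hsub : (G.skeleton T m).edges ⊆ (G ⊓ T).edges ∪
      Finset.univ.biUnion fun v => (G.someNbrs m v).image fun w => s(v, w) := by
    intro e he
    induction e with
    | h a b =>
      obtain ⟨h1, h2⟩ := mk_mem_edges.1 he
      rw [Finset.mem_union]
      rcases h2 with h | h | h
      · exact Or.inl (mk_mem_edges.2 ⟨h1, h⟩)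
      · exact Or.inr (Finset.mem_biUnion.2 ⟨a, Finset.mem_univ _, Finset.mem_image_of_mem _ h⟩)
      · refine Or.inr (Finset.mem_biUnion.2 ⟨b, Finset.mem_univ _, ?_⟩)
        rw [Sym2.eq_swap]
        exact Finset.mem_image_of_mem _ h
  refine (Finset.card_le_card hsub).trans ((Finset.card_union_le _ _).trans ?_)
  refine Nat.add_le_add_left (Finset.card_biUnion_le.trans ?_) _
  calc _ ≤ ∑ _v : V, m := Finset.sum_le_sum fun v _ =>
        Finset.card_image_le.trans ((G.card_someNbrs m v).trans_le (Nat.min_le_left _ _))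
    _ = Fintype.card V * m := by simp

/-- Every pair of large disjoint sets is joined by more than `k` edges of `G`. -/
def DenselyJoined (G : SimpleGraph V) (s k : ℕ) : Prop :=
  ∀ X Y : Finset V, Disjoint X Y → s ≤ X.card → Fintype.card V ≤ 4 * Y.card →
    k < (G.edges ∩ crossPairs X Y).card

theorem DenselyJoined.exists_adj {G T H : SimpleGraph V} {s k : ℕ}
    (h : (G ⊓ T).DenselyJoined s k) (hH : H.edges.card ≤ k) {X Y : Finset V} (hXY : Disjoint X Y)
    (hX : s ≤ X.card) (hY : Fintype.card V ≤ 4 * Y.card) :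
    ∃ x ∈ X, ∃ y ∈ Y, ((G \ H) ⊓ T).Adj x y := by
  obtain ⟨e, he, heH⟩ := Finset.exists_mem_notMem_of_card_lt_card (hH.trans_lt (h X Y hXY hX hY))
  rw [Finset.mem_inter] at he
  obtain ⟨⟨x, y⟩, hxy, rfl⟩ := Finset.mem_image.1 he.2
  rw [Finset.mem_product] at hxy
  refine ⟨x, hxy.1, y, hxy.2, ?_⟩
  have h1 := mk_mem_edges.1 he.1
  rw [mk_mem_edges] at heH
  exact ⟨⟨h1.1, heH⟩, h1.2⟩

/-- A component and its complement have no outside neighbours, so expansion forces both above `n /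
4` vertices, and then an edge joins them. -/
theorem preconnected_of_expander {G : SimpleGraph V} {s : ℕ} (hs : 4 * s ≤ Fintype.card V)
    (hjoin : ∀ X Y : Finset V, Disjoint X Y → s ≤ X.card → Fintype.card V ≤ 4 * Y.card →
      ∃ x ∈ X, ∃ y ∈ Y, G.Adj x y)
    (hexp : ∀ S : Finset V, 4 * S.card ≤ Fintype.card V → 2 * S.card ≤ (G.extNbrs S).card) :
    G.Preconnected := by
  classical
  have big : ∀ S : Finset V, S.Nonempty → G.extNbrs S = ∅ → Fintype.card V < 4 * S.card := by
    intro S hS h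
    by_contra! hcon
    have h1 := hexp S hcon
    rw [h, Finset.card_empty] at h1
    have := hS.card_pos
    omega
  intro a b
  by_contra hab
  set X : Finset V := Finset.univ.filter fun v => G.Reachable a v with hX
  have hmem : ∀ {v}, v ∈ X ↔ G.Reachable a v := by simp [hX]
  have noadj : ∀ x ∈ X, ∀ y ∉ X, ¬ G.Adj x y := fun x hx y hy hxy =>
    hy (hmem.2 ((hmem.1 hx).trans hxy.reachable))
  have h1 : G.extNbrs X = ∅ := by
    rw [Finset.eq_empty_iff_forall_notMem]
    intro y hy
    obtain ⟨hy1, x, hx, hxy⟩ := mem_extNbrs.1 hy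
    exact noadj x hx y hy1 hxy
  have h2 : G.extNbrs Xᶜ = ∅ := by
    rw [Finset.eq_empty_iff_forall_notMem]
    intro y hy
    obtain ⟨hy1, x, hx, hxy⟩ := mem_extNbrs.1 hy
    exact noadj y (by simpa using hy1) x (by simpa using hx) hxy.symm
  have h3 := big X ⟨a, hmem.2 (Reachable.refl a)⟩ h1
  have h4 := big Xᶜ ⟨b, by simpa [hmem] using hab⟩ h2
  obtain ⟨x, hx, y, hy, hxy⟩ := hjoin X Xᶜ disjoint_compl_right (by omega) (by omega)
  exact noadj x hx y (by simpa using hy) hxy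

theorem extNbrs_mono {G H : SimpleGraph V} (h : G ≤ H) (S : Finset V) :
    G.extNbrs S ⊆ H.extNbrs S := by
  intro v hv
  rw [mem_extNbrs] at hv ⊢
  obtain ⟨h1, u, hu, huv⟩ := hv
  exact ⟨h1, u, hu, h huv⟩

theorem card_edges_sup_fromEdgeSet_le (G : SimpleGraph V) (e : Sym2 V) :
    (G ⊔ fromEdgeSet {e}).edges.card ≤ G.edges.card + 1 := by
  refine (Finset.card_le_card fun f hf => ?_).trans (Finset.card_insert_le e G.edges)
  rw [mem_edges, edgeSet_sup, edgeSet_fromEdgeSet] at hf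
  rw [Finset.mem_insert, mem_edges]
  rcases hf with h | h
  · exact Or.inr h
  · exact Or.inl h.1

/-- Every sparse subgraph with many boosters has more than `k` boosters among the edges of `G`. -/
def HasBoosters (G : SimpleGraph V) (M k : ℕ) : Prop :=
  ∀ Γ : SimpleGraph V, Γ ≤ G → Γ.edges.card ≤ M → Fintype.card V ^ 2 ≤ 32 * Γ.boosters.card →
    k < (G.edges ∩ Γ.boosters).card

/-- Expansion and connectedness survive the addition of edges, so each step finds a new booster
outside `H`. If no Hamiltonian cycle ever appeared, `n + 1` steps would give a path on more than `n`
vertices; the term `Fintype.card V` in `hM` pays for the added edges. -/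
theorem isHamiltonian_of_expander {G H Γ : SimpleGraph V} {M k : ℕ} (h3 : 3 ≤ Fintype.card V)
    (hΓ : Γ ≤ G \ H) (hΓc : Γ.Preconnected)
    (hexp : ∀ S : Finset V, 4 * S.card ≤ Fintype.card V → 2 * S.card ≤ (Γ.extNbrs S).card)
    (hM : Γ.edges.card + Fintype.card V ≤ M) (hb : G.HasBoosters M k)
    (hH : H.edges.card ≤ k) : (G \ H).IsHamiltonian := by
  by_contra hcon
  have hne : Nonempty V := Fintype.card_pos_iff.1 (by omega)
  have step : ∀ j ≤ Fintype.card V + 1, ∃ Δ : SimpleGraph V, Γ ≤ Δ ∧ Δ ≤ G \ H ∧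
      Δ.edges.card ≤ Γ.edges.card + j ∧ j ≤ Δ.pathNumber := by
    intro j
    induction j with
    | zero => exact fun _ => ⟨Γ, le_rfl, hΓ, le_rfl, Nat.zero_le _⟩
    | succ j ih =>
      intro hj
      obtain ⟨Δ, h1, h2, h3', h4⟩ := ih (by omega)
      have hexp' : ∀ S : Finset V, 4 * S.card ≤ Fintype.card V →
          2 * S.card ≤ (Δ.extNbrs S).card := fun S hS =>
        (hexp S hS).trans (Finset.card_le_card (extNbrs_mono h1 S))
      have hnH : ¬ Δ.IsHamiltonian := fun h => hcon (h.mono h2)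
      have hmany := sq_card_le_boosters ⟨hΓc.mono h1⟩ hnH h3 hexp'
      have hlt := hb Δ (h2.trans sdiff_le) (by omega) hmany
      obtain ⟨e, he, heH⟩ := Finset.exists_mem_notMem_of_card_lt_card (hH.trans_lt hlt)
      rw [Finset.mem_inter, mem_boosters, mem_edges] at he
      rw [mem_edges] at heH
      have hle : Δ ⊔ fromEdgeSet {e} ≤ G \ H := by
        refine sup_le h2 ?_
        rw [← edgeSet_subset_edgeSet, edgeSet_fromEdgeSet, edgeSet_sdiff]
        rintro f ⟨rfl, -⟩
        exact ⟨he.1, heH⟩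
      refine ⟨Δ ⊔ fromEdgeSet {e}, h1.trans le_sup_left, hle, ?_, ?_⟩
      · have := Δ.card_edges_sup_fromEdgeSet_le e
        omega
      · rcases he.2.2.2 with h | h
        · exact absurd (h.mono hle) hcon
        · omega
  obtain ⟨Δ, -, -, -, h⟩ := step _ le_rfl
  have := Δ.pathNumber_le
  omega

/-- The deterministic properties of a graph that make its Hamiltonicity resilient. -/
structure ResilienceWitness (G T : SimpleGraph V) (m s M k : ℕ) : Prop where
  sparse : G.LocallySparse m s
  scattered : G.LowDegreeScattered (3 * m)
  joined : (G ⊓ T).DenselyJoined s k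
  boosters : G.HasBoosters M k
  four_mul_le : 4 * s ≤ Fintype.card V
  card_edges_le : (G ⊓ T).edges.card + Fintype.card V * m + Fintype.card V ≤ M

theorem ResilienceWitness.isHamiltonian_sdiff {G T H : SimpleGraph V} {m s M k d : ℕ}
    (hG : G.ResilienceWitness T m s M k) (h3 : 3 ≤ Fintype.card V) (hm : 2 ≤ m)
    (hd : ∀ v, d ≤ (G.nbrs v).card) (hdk : d ≤ k) (hH : H.edges.card + 2 ≤ d) :
    (G \ H).IsHamiltonian := by
  classical
  have hdeg : ∀ v, (G.nbrs v).card ≤ ((G \ H).nbrs v).card + H.edges.card := fun v =>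
    (G.card_nbrs_le_add H v).trans (Nat.add_le_add_left (H.card_nbrs_le_card_edges v) _)
  set G' := G \ H with hG'
  have hG'G : G' ≤ G := sdiff_le
  set Γ := G'.skeleton T m with hΓ
  have hΓG' : Γ ≤ G' := G'.skeleton_le T m
  have hdegΓ : ∀ v, min m (G'.nbrs v).card ≤ (Γ.nbrs v).card :=
    G'.min_le_card_nbrs_skeleton T m
  set B : Finset V := Finset.univ.filter fun v => (G'.nbrs v).card < m with hB
  have memB : ∀ {v}, v ∈ B ↔ (G'.nbrs v).card < m := by simp [hB]
  have h2 : ∀ v ∈ B, 2 ≤ (Γ.nbrs v).card := by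
    intro v _
    have := hdeg v
    have := hd v
    have := hdegΓ v
    omega
  have hjoin : ∀ X Y : Finset V, Disjoint X Y → s ≤ X.card → Fintype.card V ≤ 4 * Y.card →
      ∃ x ∈ X, ∃ y ∈ Y, Γ.Adj x y := by
    intro X Y hXY hX hY
    obtain ⟨x, hx, y, hy, hxy⟩ := hG.joined.exists_adj (H := H) (by omega) hXY hX hY
    exact ⟨x, hx, y, hy, G'.inf_le_skeleton T m hxy⟩
  have hexp : ∀ S : Finset V, 4 * S.card ≤ Fintype.card V →
      2 * S.card ≤ (Γ.extNbrs S).card := by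
    intro S hS
    by_cases hs : S.card ≤ s
    · have h5 : 5 * (S \ B).card ≤ (Γ.extNbrs (S \ B)).card := by
        refine hG.sparse.five_mul_card_le (hΓG'.trans hG'G)
          ((Finset.card_le_card Finset.sdiff_subset).trans hs) fun v hv => ?_
        have hvB := (Finset.mem_sdiff.1 hv).2
        rw [memB] at hvB
        have := hdegΓ v
        omega
      -- For large minimum degree `H` is too small to push two vertices below degree `m`: each would
      -- lose more than `d - m` edges, and at most one edge is shared.
      by_cases hmd : 2 * m ≤ d
      · refine two_mul_card_le_of_card_le_one ?_ h2 h5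
        rw [Finset.card_le_one]
        intro u hu v hv
        by_contra huv
        rw [memB] at hu hv
        have h6 : _ ≤ (G'.nbrs u).card + _ := G.card_nbrs_le_add H u
        have h7 : _ ≤ (G'.nbrs v).card + _ := G.card_nbrs_le_add H v
        have h8 := H.card_nbrs_add_card_nbrs_le huv
        have h9 := hd u
        have h10 := hd v
        omega
      -- Here `d < 2 * m`, so a vertex of degree below `m` in `G \ H` had degree below `m + d < 3 *
      -- m` in `G`.
      · refine Scattered.two_mul_card_le
          ((hG.scattered.scattered fun v hv => ?_).mono (hΓG'.trans hG'G)) h2 h5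
        rw [memB] at hv
        have := hdeg v
        omega
    -- A large set that failed to expand would leave at least a quarter of the vertices outside `S`
    -- and its neighbourhood, contradicting `hjoin`.
    · by_contra! hcon
      have hdisj : Disjoint S (S ∪ Γ.extNbrs S)ᶜ := by
        rw [Finset.disjoint_left]
        intro v hv hv'
        exact Finset.mem_compl.1 hv' (Finset.mem_union_left _ hv)
      have hcard := Finset.card_compl (S ∪ Γ.extNbrs S)
      have hle := Finset.card_union_le S (Γ.extNbrs S)
      obtain ⟨x, hx, y, hy, hxy⟩ := hjoin S _ hdisj (by omega) (by omega)
      rw [Finset.mem_compl, Finset.mem_union, mem_extNbrs, not_or] at hy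
      exact hy.2 ⟨hy.1, x, hx, hxy⟩
  refine isHamiltonian_of_expander h3 hΓG' (preconnected_of_expander hG.four_mul_le hjoin hexp)
    hexp ?_ hG.boosters (by omega)
  have h6 : Γ.edges.card ≤ _ := G'.card_edges_skeleton_le T m
  have h7 : (G' ⊓ T).edges.card ≤ (G ⊓ T).edges.card :=
    Finset.card_le_card (edges_mono (inf_le_inf_right T hG'G))
  have h8 := hG.card_edges_le
  omega

/-- Deleting all but one of the edges at a vertex destroys Hamiltonicity. -/
theorem exists_le_not_isHamiltonian (G : SimpleGraph V) (v : V) (hv : 0 < (G.nbrs v).card) :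
    ∃ H ≤ G, H.edges.card = (G.nbrs v).card - 1 ∧ ¬ (G \ H).IsHamiltonian := by
  obtain ⟨w, hw⟩ := Finset.card_pos.1 hv
  have hvw := mem_nbrs.1 hw
  set E : Finset (Sym2 V) := ((G.nbrs v).erase w).image fun x => s(v, x) with hE
  have hEG : E ⊆ G.edges :=
    (Finset.image_subset_image (Finset.erase_subset _ _)).trans (G.image_nbrs_subset_edges v)
  have hEe : (fromEdgeSet (E : Set (Sym2 V))).edges = E := by
    ext e
    rw [mem_edges, edgeSet_fromEdgeSet, Set.mem_sdiff, Finset.mem_coe]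
    exact ⟨fun h => h.1, fun h => ⟨h, G.not_isDiag_of_mem_edgeSet (mem_edges.1 (hEG h))⟩⟩
  have hmemE : ∀ {x}, s(v, x) ∈ E ↔ x ≠ w ∧ G.Adj v x := by
    intro x
    rw [hE, Finset.mem_image]
    constructor
    · rintro ⟨y, hy, h⟩
      rw [Sym2.congr_right] at h
      subst h
      rwa [Finset.mem_erase, mem_nbrs] at hy
    · intro h
      exact ⟨x, Finset.mem_erase.2 ⟨h.1, mem_nbrs.2 h.2⟩, rfl⟩
  refine ⟨fromEdgeSet (E : Set (Sym2 V)), ?_, ?_, ?_⟩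
  · rw [← edgeSet_subset_edgeSet]
    intro e he
    rw [← mem_edges, hEe] at he
    exact mem_edges.1 (hEG he)
  · rw [hEe, hE, Finset.card_image_of_injective _ fun a b h => Sym2.congr_right.1 h,
      Finset.card_erase_of_mem hw]
  · have honly : ∀ x, (G \ fromEdgeSet (E : Set (Sym2 V))).Adj v x → x = w := by
      intro x hx
      rw [sdiff_adj, fromEdgeSet_adj, Finset.mem_coe, hmemE] at hx
      by_contra hxw
      exact hx.2 ⟨⟨hxw, hx.1⟩, hx.1.ne⟩
    refine IsBridge.not_isHamiltonian (e := s(v, w)) ?_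
    rw [isBridge_iff]
    rintro ⟨q⟩
    cases q with
    | nil => exact hvw.ne rfl
    | cons h q =>
      rw [deleteEdges_adj] at h
      have := honly _ h.1
      subst this
      exact h.2 rfl

theorem globalResilience_le (G : SimpleGraph V) (v : V) (hv : 0 < (G.nbrs v).card) :
    globalResilience (fun G' : SimpleGraph V => G'.IsHamiltonian) G ≤ (G.nbrs v).card - 1 := by
  obtain ⟨H, h1, h2, h3⟩ := G.exists_le_not_isHamiltonian v hv
  exact Nat.sInf_le ⟨H, h1, by rw [← card_edges, h2], h3⟩

theorem ResilienceWitness.globalResilience_eq {G T : SimpleGraph V} {m s M k : ℕ}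
    (hG : G.ResilienceWitness T m s M k) (h3 : 3 ≤ Fintype.card V) (hm : 2 ≤ m) {v : V}
    (hmin : ∀ w, (G.nbrs v).card ≤ (G.nbrs w).card) (hk : (G.nbrs v).card ≤ k)
    (hpos : 0 < (G.nbrs v).card) :
    globalResilience (fun G' : SimpleGraph V => G'.IsHamiltonian) G = (G.nbrs v).card - 1 := by
  refine le_antisymm (G.globalResilience_le v hpos) ?_
  obtain ⟨H, -, h2, h4⟩ := globalResilience_mem (fun G' : SimpleGraph V => G'.IsHamiltonian) G
    (not_isHamiltonian_bot_of_card_ne_one (by omega))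
  by_contra! hcon
  rw [← h2, ← card_edges] at hcon
  exact h4 (hG.isHamiltonian_sdiff h3 hm hmin hk (by omega))

end Resilience

/-! ### Exponential moments and tail bounds in the random graph. -/

section Chernoff

variable {V : Type*} [Fintype V]

open scoped Classical in
/-- The non-diagonal pairs of vertices. -/
noncomputable def allPairs (V : Type*) [Fintype V] : Finset (Sym2 V) :=
  Finset.univ.filter fun e => ¬ e.IsDiag

theorem mem_allPairs {e : Sym2 V} : e ∈ allPairs V ↔ ¬ e.IsDiag := by
  simp [allPairs]

theorem edges_subset_allPairs (G : SimpleGraph V) : G.edges ⊆ allPairs V := fun _ he =>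
  mem_allPairs.2 (G.not_isDiag_of_mem_edgeSet (mem_edges.1 he))

theorem card_allPairs : (allPairs V).card = (Fintype.card V).choose 2 := by
  classical
  have h : allPairs V = (⊤ : SimpleGraph V).edgeFinset := by
    ext e
    simp [mem_allPairs]
  rw [h, card_edgeFinset_top_eq_card_choose_two]

theorem edges_fromEdgeSet {E : Finset (Sym2 V)} (hE : E ⊆ allPairs V) :
    (fromEdgeSet (E : Set (Sym2 V))).edges = E := by
  ext e
  rw [mem_edges, edgeSet_fromEdgeSet, Set.mem_sdiff, Finset.mem_coe]
  exact ⟨fun h => h.1, fun h => ⟨h, mem_allPairs.1 (hE h)⟩⟩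

theorem fromEdgeSet_edges (G : SimpleGraph V) : fromEdgeSet (G.edges : Set (Sym2 V)) = G := by
  rw [← fromEdgeSet_edgeSet G]
  congr 1
  ext e
  simp [mem_edges]

theorem sum_graphs_eq_sum_powerset [Fintype (SimpleGraph V)] (f : Finset (Sym2 V) → ℝ) :
    ∑ G : SimpleGraph V, f G.edges = ∑ E ∈ (allPairs V).powerset, f E := by
  refine Finset.sum_bij' (fun G _ => G.edges) (fun E _ => fromEdgeSet (E : Set (Sym2 V))) ?_ ?_
    ?_ ?_ ?_
  · intro G _
    exact Finset.mem_powerset.2 G.edges_subset_allPairs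
  · intro E _
    exact Finset.mem_univ _
  · intro G _
    exact G.fromEdgeSet_edges
  · intro E hE
    exact edges_fromEdgeSet (Finset.mem_powerset.1 hE)
  · intro G _
    rfl

variable (p : unitInterval)

theorem measurableSingletonClass : MeasurableSingletonClass (SimpleGraph V) :=
  ⟨fun G => by
    have h := measurableEmbedding_edgeSet.measurable (MeasurableSet.singleton G.edgeSet)
    rwa [← Set.image_singleton, edgeSet_injective.preimage_image] at h⟩

theorem binomialRandom_real_le_sum [Fintype (SimpleGraph V)] {S : Set (SimpleGraph V)}
    {g : SimpleGraph V → ℝ} (h0 : ∀ G, 0 ≤ g G) (h1 : ∀ G ∈ S, 1 ≤ g G) :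
    (binomialRandom V p).real S ≤ ∑ G, (binomialRandom V p).real {G} * g G := by
  classical
  have hS : S = ((Finset.univ.filter (· ∈ S) : Finset (SimpleGraph V)) : Set (SimpleGraph V)) := by
    simp
  have := measurableSingletonClass (V := V)
  rw [hS, ← MeasureTheory.sum_measureReal_singleton, Finset.sum_filter]
  refine Finset.sum_le_sum fun G _ => ?_
  split_ifs with h
  · exact le_mul_of_one_le_right MeasureTheory.measureReal_nonneg (h1 G h)
  · exact mul_nonneg MeasureTheory.measureReal_nonneg (h0 G)

theorem one_sub_add_mul_pow_le (a : ℝ) (ha : 0 ≤ a) (k : ℕ) :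
    (1 - (p : ℝ) + p * a) ^ k ≤ Real.exp ((p : ℝ) * k * (a - 1)) := by
  have h0 : 0 ≤ 1 - (p : ℝ) + p * a :=
    add_nonneg (sub_nonneg.2 p.2.2) (mul_nonneg p.2.1 ha)
  calc (1 - (p : ℝ) + p * a) ^ k ≤ Real.exp ((p : ℝ) * (a - 1)) ^ k := by
        refine pow_le_pow_left₀ h0 ?_ k
        have := Real.add_one_le_exp ((p : ℝ) * (a - 1))
        linarith
    _ = Real.exp ((p : ℝ) * k * (a - 1)) := by
        rw [← Real.exp_nat_mul]
        congr 1
        ring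

variable [DecidableEq V]

theorem binomialRandom_real_singleton (G : SimpleGraph V) :
    (binomialRandom V p).real {G} =
      (p : ℝ) ^ G.edges.card * (1 - (p : ℝ)) ^ (allPairs V \ G.edges).card := by
  rw [Finset.card_sdiff_of_subset G.edges_subset_allPairs, card_allPairs, card_edges,
    MeasureTheory.measureReal_def, binomialRandom_singleton]
  simp

/-- Independence of the pairs: expanding a product over all pairs gives the sum over all graphs. The
presence of `P` contributes exactly `p ^ P.card`, which the union bounds over `P` rely on. -/
theorem sum_weight_eq [Fintype (SimpleGraph V)] {P F : Finset (Sym2 V)} (hP : P ⊆ allPairs V)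
    (hF : F ⊆ allPairs V) (hPF : Disjoint P F) (a : ℝ) :
    ∑ G : SimpleGraph V, (binomialRandom V p).real {G} *
        (if P ⊆ G.edges then a ^ (G.edges ∩ F).card else 0) =
      (p : ℝ) ^ P.card * (1 - (p : ℝ) + p * a) ^ F.card := by
  have h1 : ∏ e ∈ allPairs V, ((p : ℝ) * (if e ∈ F then a else 1) +
      (1 - (p : ℝ)) * (if e ∈ P then 0 else 1)) =
      (p : ℝ) ^ P.card * (1 - (p : ℝ) + p * a) ^ F.card := by
    have : ∀ e ∈ allPairs V, ((p : ℝ) * (if e ∈ F then a else 1) +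
      (1 - (p : ℝ)) * (if e ∈ P then 0 else 1)) =
        (if e ∈ P then (p : ℝ) else 1) * (if e ∈ F then (1 - (p : ℝ) + p * a) else 1) := by
      intro e _
      by_cases h1 : e ∈ P
      · have h2 : e ∉ F := Finset.disjoint_left.1 hPF h1
        simp [h1, h2]
      · by_cases h2 : e ∈ F
        · simp [h1, h2]; ring
        · simp [h1, h2]
    rw [Finset.prod_congr rfl this, Finset.prod_mul_distrib, Finset.prod_ite_mem,
      Finset.prod_ite_mem, Finset.prod_const, Finset.prod_const,
      Finset.inter_eq_right.2 hP, Finset.inter_eq_right.2 hF]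
  rw [← h1, Finset.prod_add]
  rw [← sum_graphs_eq_sum_powerset fun E =>
    (∏ e ∈ E, (p : ℝ) * (if e ∈ F then a else 1)) *
      ∏ e ∈ allPairs V \ E, (1 - (p : ℝ)) * (if e ∈ P then 0 else 1)]
  refine Finset.sum_congr rfl fun G _ => ?_
  rw [binomialRandom_real_singleton, Finset.prod_mul_distrib, Finset.prod_mul_distrib,
    Finset.prod_const, Finset.prod_const, Finset.prod_ite_mem, Finset.prod_const]
  split_ifs with h
  · have : ∏ e ∈ allPairs V \ G.edges, (if e ∈ P then (0 : ℝ) else 1) = 1 :=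
      Finset.prod_eq_one fun e he => if_neg fun heP => (Finset.mem_sdiff.1 he).2 (h heP)
    rw [this]
    ring
  · obtain ⟨e, heP, heG⟩ := Finset.not_subset.1 h
    have : ∏ e ∈ allPairs V \ G.edges, (if e ∈ P then (0 : ℝ) else 1) = 0 :=
      Finset.prod_eq_zero (Finset.mem_sdiff.2 ⟨hP heP, heG⟩) (if_pos heP)
    rw [this]
    ring

/-- Lower tail: the edges of `P` are present and few edges of `F` are. -/
theorem binomialRandom_real_lower_tail {P F : Finset (Sym2 V)} (hP : P ⊆ allPairs V)
    (hF : F ⊆ allPairs V) (hPF : Disjoint P F) {t : ℝ} (ht : 0 ≤ t) (x : ℝ) :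
    (binomialRandom V p).real {G | P ⊆ G.edges ∧ ((G.edges ∩ F).card : ℝ) ≤ x} ≤
      (p : ℝ) ^ P.card * Real.exp (t * x - p * F.card * (1 - Real.exp (-t))) := by
  classical
  refine (binomialRandom_real_le_sum p (g := fun G => Real.exp (t * x) *
    (if P ⊆ G.edges then Real.exp (-t) ^ (G.edges ∩ F).card else 0)) ?_ ?_).trans ?_
  · intro G
    positivity
  · rintro G ⟨h1, h2⟩
    rw [if_pos h1, ← Real.exp_nat_mul, ← Real.exp_add]
    refine Real.one_le_exp ?_
    nlinarith
  · have : ∀ G : SimpleGraph V, (binomialRandom V p).real {G} * (Real.exp (t * x) *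
        (if P ⊆ G.edges then Real.exp (-t) ^ (G.edges ∩ F).card else 0)) = Real.exp (t * x) *
        ((binomialRandom V p).real {G} *
          (if P ⊆ G.edges then Real.exp (-t) ^ (G.edges ∩ F).card else 0)) := fun G => by ring
    simp_rw [this]
    rw [← Finset.mul_sum, sum_weight_eq p hP hF hPF]
    have h := one_sub_add_mul_pow_le p (Real.exp (-t)) (Real.exp_pos _).le F.card
    calc _ ≤ Real.exp (t * x) *
          ((p : ℝ) ^ P.card * Real.exp ((p : ℝ) * F.card * (Real.exp (-t) - 1))) := by
          gcongr
          exact pow_nonneg p.2.1 _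
      _ = (p : ℝ) ^ P.card * (Real.exp (t * x) *
          Real.exp ((p : ℝ) * F.card * (Real.exp (-t) - 1))) := by ring
      _ = _ := by
          rw [← Real.exp_add]
          congr 2
          ring

/-- Upper tail for the number of edges in `F`. -/
theorem binomialRandom_real_upper_tail {F : Finset (Sym2 V)} (hF : F ⊆ allPairs V) {t : ℝ}
    (ht : 0 ≤ t) (x : ℝ) :
    (binomialRandom V p).real {G | x ≤ ((G.edges ∩ F).card : ℝ)} ≤
      Real.exp (p * F.card * (Real.exp t - 1) - t * x) := by
  classical
  refine (binomialRandom_real_le_sum p (g := fun G => Real.exp (-(t * x)) *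
    (if (∅ : Finset (Sym2 V)) ⊆ G.edges then Real.exp t ^ (G.edges ∩ F).card else 0))
    ?_ ?_).trans ?_
  · intro G
    positivity
  · intro G h1
    rw [Set.mem_ofPred_eq] at h1
    rw [if_pos (Finset.empty_subset _), ← Real.exp_nat_mul, ← Real.exp_add]
    refine Real.one_le_exp ?_
    nlinarith
  · have : ∀ G : SimpleGraph V, (binomialRandom V p).real {G} * (Real.exp (-(t * x)) *
        (if (∅ : Finset (Sym2 V)) ⊆ G.edges then Real.exp t ^ (G.edges ∩ F).card else 0)) =
        Real.exp (-(t * x)) * ((binomialRandom V p).real {G} *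
        (if (∅ : Finset (Sym2 V)) ⊆ G.edges then Real.exp t ^ (G.edges ∩ F).card else 0)) :=
      fun G => by ring
    simp_rw [this]
    rw [← Finset.mul_sum, sum_weight_eq p (Finset.empty_subset _) hF (Finset.disjoint_empty_left F)]
    have h := one_sub_add_mul_pow_le p (Real.exp t) (Real.exp_pos _).le F.card
    calc _ ≤ Real.exp (-(t * x)) *
          ((p : ℝ) ^ (∅ : Finset (Sym2 V)).card *
            Real.exp ((p : ℝ) * F.card * (Real.exp t - 1))) := by
          gcongr
          exact pow_nonneg p.2.1 _
      _ = _ := by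
          rw [Finset.card_empty, pow_zero, one_mul, ← Real.exp_add]
          congr 1
          ring

end Chernoff

/-! ### Union bounds for boosters and local sparsity. -/

section UnionBounds

variable {V : Type*} [Fintype V] (p : unitInterval)

theorem binomialRandom_real_le_sum_of_subset {ι : Type*} (I : Finset ι)
    (A : ι → Set (SimpleGraph V)) {S : Set (SimpleGraph V)} {b : ι → ℝ}
    (hS : ∀ G ∈ S, ∃ i ∈ I, G ∈ A i) (hb : ∀ i ∈ I, (binomialRandom V p).real (A i) ≤ b i) :
    (binomialRandom V p).real S ≤ ∑ i ∈ I, b i := by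
  calc (binomialRandom V p).real S ≤ (binomialRandom V p).real (⋃ i ∈ I, A i) := by
        refine MeasureTheory.measureReal_mono (fun G hG => ?_)
          (MeasureTheory.measure_ne_top _ _)
        obtain ⟨i, hi, h⟩ := hS G hG
        exact Set.mem_biUnion hi h
    _ ≤ ∑ i ∈ I, (binomialRandom V p).real (A i) :=
        MeasureTheory.measureReal_biUnion_finset_le I A
    _ ≤ ∑ i ∈ I, b i := Finset.sum_le_sum hb

theorem sum_pow_card_powerset_le {α : Type*} [DecidableEq α] (s : Finset α) {x : ℝ} (hx : 0 ≤ x) :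
    ∑ E ∈ s.powerset, x ^ E.card ≤ Real.exp (s.card * x) := by
  have h := Finset.prod_add (fun _ : α => x) (fun _ => 1) s
  simp only [Finset.prod_const, one_pow, mul_one] at h
  rw [← h, Real.exp_nat_mul]
  exact pow_le_pow_left₀ (by linarith) (Real.add_one_le_exp x) _

theorem half_le_one_sub_exp_neg_one : (1 / 2 : ℝ) ≤ 1 - Real.exp (-1) := by
  have := Real.exp_neg_one_lt_half
  linarith

theorem card_allPairs_le : ((allPairs V).card : ℝ) ≤ (Fintype.card V : ℝ) ^ 2 / 2 := by
  rw [card_allPairs, Nat.cast_choose_two]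
  have : (0 : ℝ) ≤ Fintype.card V := Nat.cast_nonneg _
  nlinarith

variable [DecidableEq V]

/-- `Γ` and its boosters are disjoint sets of pairs, so the cost `p ^ Γ.edges.card` of containing
`Γ` multiplies the lower tail `exp (k - n ^ 2 * p / 64)`. Summing over `Γ` with at most `M` edges
costs only a smaller multiple of `n ^ 2 * p` in the exponent. -/
theorem binomialRandom_real_not_hasBoosters_le {M k : ℕ} (hn : 4000 ≤ Fintype.card V)
    (hM : (M : ℝ) ≤ (Fintype.card V : ℝ) ^ 2 * p / 1000)
    (hk : (k : ℝ) ≤ 4 * (Fintype.card V * p)) :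
    (binomialRandom V p).real {G | ¬ G.HasBoosters M k} ≤
      Real.exp (-((Fintype.card V : ℝ) ^ 2 * p / 200)) := by
  classical
  set n : ℝ := (Fintype.card V : ℝ) with hn'
  have hp0 : (0 : ℝ) ≤ p := p.2.1
  have hnr : (4000 : ℝ) ≤ n := by rw [hn']; exact_mod_cast hn
  set x : ℝ := (p : ℝ) * Real.exp (-5) with hx
  have hx0 : 0 ≤ x := mul_nonneg hp0 (Real.exp_pos _).le
  set I : Finset (SimpleGraph V) := Finset.univ.filter fun Γ =>
    Γ.edges.card ≤ M ∧ Fintype.card V ^ 2 ≤ 32 * Γ.boosters.card with hI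
  have h1 : (binomialRandom V p).real {G | ¬ G.HasBoosters M k} ≤
      ∑ Γ ∈ I, Real.exp (5 * M + k - n ^ 2 * p / 64) * x ^ Γ.edges.card := by
    refine binomialRandom_real_le_sum_of_subset p I
      (fun Γ => {G | Γ.edges ⊆ G.edges ∧ ((G.edges ∩ Γ.boosters).card : ℝ) ≤ k}) ?_ ?_
    · intro G hG
      simp only [HasBoosters, Set.mem_ofPred_eq, not_forall, not_lt] at hG
      obtain ⟨Γ, h1, h2, h3, h4⟩ := hG
      exact ⟨Γ, by simp [hI, h2, h3], edges_mono h1, by exact_mod_cast h4⟩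
    · intro Γ hΓ
      obtain ⟨hΓM, hΓb⟩ : Γ.edges.card ≤ M ∧ Fintype.card V ^ 2 ≤ 32 * Γ.boosters.card := by
        simpa [hI] using hΓ
      have hB : Γ.boosters ⊆ allPairs V := fun e he => mem_allPairs.2 (mem_boosters.1 he).1
      have hd : Disjoint Γ.edges Γ.boosters := by
        rw [Finset.disjoint_left]
        intro e he he'
        exact (mem_boosters.1 he').2.1 (mem_edges.1 he)
      refine (binomialRandom_real_lower_tail p Γ.edges_subset_allPairs hB hd zero_le_one
        (k : ℝ)).trans ?_
      have hb : n ^ 2 ≤ 32 * (Γ.boosters.card : ℝ) := by rw [hn']; exact_mod_cast hΓb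
      have he : Real.exp (1 * k - p * Γ.boosters.card * (1 - Real.exp (-1))) ≤
          Real.exp (k - n ^ 2 * p / 64) := by
        rw [Real.exp_le_exp]
        have h2 := half_le_one_sub_exp_neg_one
        have h3 : (p : ℝ) * n ^ 2 / 32 ≤ p * Γ.boosters.card := by nlinarith
        have h4 : (p : ℝ) * Γ.boosters.card * (1 / 2) ≤
            p * Γ.boosters.card * (1 - Real.exp (-1)) :=
          mul_le_mul_of_nonneg_left h2 (by positivity)
        linarith
      -- Tilting by `exp (-5)` per edge replaces the restriction to at most `M` edges, so the sum
      -- can run over all graphs as a binomial expansion.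
      have hpow : (p : ℝ) ^ Γ.edges.card ≤ Real.exp (5 * M) * x ^ Γ.edges.card := by
        rw [hx, mul_pow, ← Real.exp_nat_mul, mul_left_comm, ← Real.exp_add]
        refine le_mul_of_one_le_right (pow_nonneg hp0 _) (Real.one_le_exp ?_)
        have : (Γ.edges.card : ℝ) ≤ M := by exact_mod_cast hΓM
        linarith
      calc _ ≤ (Real.exp (5 * M) * x ^ Γ.edges.card) * Real.exp (k - n ^ 2 * p / 64) := by
            gcongr
        _ = _ := by
            rw [mul_right_comm, ← Real.exp_add]
            congr 2
            ring
  have h2 : ∑ Γ ∈ I, x ^ Γ.edges.card ≤ Real.exp (n ^ 2 * p / 256) := by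
    calc ∑ Γ ∈ I, x ^ Γ.edges.card ≤ ∑ Γ : SimpleGraph V, x ^ Γ.edges.card :=
          Finset.sum_le_sum_of_subset_of_nonneg (Finset.subset_univ _)
            fun _ _ _ => pow_nonneg hx0 _
      _ = ∑ E ∈ (allPairs V).powerset, x ^ E.card :=
          sum_graphs_eq_sum_powerset fun E => x ^ E.card
      _ ≤ Real.exp ((allPairs V).card * x) := sum_pow_card_powerset_le _ hx0
      _ ≤ Real.exp (n ^ 2 * p / 256) := by
          rw [Real.exp_le_exp]
          have h3 : Real.exp (-5) ≤ 1 / 128 := by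
            have h4 : Real.exp (-5) = Real.exp (-1) ^ 5 := by
              rw [← Real.exp_nat_mul]; norm_num
            have h5 := Real.exp_neg_one_lt_d9
            rw [h4]
            calc Real.exp (-1) ^ 5 ≤ (0.37 : ℝ) ^ 5 :=
                  pow_le_pow_left₀ (Real.exp_pos _).le (by linarith) 5
              _ ≤ 1 / 128 := by norm_num
          have h4 : x ≤ p / 128 := by rw [hx]; nlinarith
          calc ((allPairs V).card : ℝ) * x ≤ (n ^ 2 / 2) * (p / 128) :=
                mul_le_mul card_allPairs_le h4 hx0 (by positivity)
            _ = n ^ 2 * p / 256 := by ring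
  rw [← Finset.mul_sum] at h1
  refine (h1.trans (mul_le_mul_of_nonneg_left h2 (Real.exp_pos _).le)).trans ?_
  rw [← Real.exp_add, Real.exp_le_exp]
  have h3 : 4000 * (n * p) ≤ n ^ 2 * p := by nlinarith [mul_nonneg (by linarith : 0 ≤ n) hp0]
  nlinarith [mul_nonneg (sq_nonneg n) hp0]

theorem binomialRandom_real_not_locallySparse_le {m s : ℕ} {η : ℝ} (hη : 0 < η)
    (hm : η * (Fintype.card V * p) ≤ m)
    (hs : 6 * (s : ℝ) ≤ Real.exp (-(36 / η)) * Fintype.card V)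
    (hd : Real.log (Fintype.card V) ≤ Fintype.card V * p) :
    (binomialRandom V p).real {G | ¬ G.LocallySparse m s} ≤
      Real.exp (Real.exp (-(Fintype.card V * p))) - 1 := by
  classical
  set n : ℝ := (Fintype.card V : ℝ) with hn'
  have hp0 : (0 : ℝ) ≤ p := p.2.1
  set d : ℝ := n * p with hdd
  have hd0 : 0 ≤ d := mul_nonneg (Nat.cast_nonneg _) hp0
  set I : Finset (Finset V) := Finset.univ.filter fun U => U.Nonempty ∧ U.card ≤ 6 * s with hI
  have h1 : (binomialRandom V p).real {G | ¬ G.LocallySparse m s} ≤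
      ∑ U ∈ I, Real.exp (-(2 * d)) ^ U.card := by
    refine binomialRandom_real_le_sum_of_subset p I
      (fun U => {G | (m : ℝ) * U.card / 12 ≤ ((G.edges ∩ (allPairs V ∩ U.sym2)).card : ℝ)}) ?_ ?_
    · intro G hG
      simp only [LocallySparse, Set.mem_ofPred_eq, not_forall, not_lt] at hG
      obtain ⟨U, h1, h2, h3⟩ := hG
      refine ⟨U, by simp [hI, h1, h2], ?_⟩
      rw [Set.mem_ofPred_eq, ← Finset.inter_assoc,
        Finset.inter_eq_left.2 G.edges_subset_allPairs, div_le_iff₀ (by norm_num)]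
      have : ((m * U.card : ℕ) : ℝ) ≤ ((12 * (G.edges ∩ U.sym2).card : ℕ) : ℝ) := by
        exact_mod_cast h3
      push_cast at this
      linarith
    · intro U hU
      obtain ⟨hUn, hUs⟩ : U.Nonempty ∧ U.card ≤ 6 * s := by simpa [hI] using hU
      set u : ℝ := (U.card : ℝ) with hu
      have hu0 : 0 < u := by rw [hu]; exact_mod_cast hUn.card_pos
      have hun : u ≤ n := by rw [hu, hn']; exact_mod_cast U.card_le_univ
      have hn0 : 0 < n := hu0.trans_le hun
      have hus : u ≤ Real.exp (-(36 / η)) * n := by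
        refine le_trans ?_ hs
        rw [hu]; exact_mod_cast hUs
      -- The Chernoff parameter is chosen so that the moment term is at most `exp (d * u)`, while
      -- the deviation term is at least `3 * d * u` because `u` is at most `exp (-(36 / η)) * n`.
      set L := Real.log (n / u) with hL
      have hexpL : Real.exp L = n / u := Real.exp_log (by positivity)
      have hL36 : 36 / η ≤ L := by
        rw [hL, Real.le_log_iff_exp_le (by positivity), le_div_iff₀ hu0]
        calc Real.exp (36 / η) * u ≤ Real.exp (36 / η) * (Real.exp (-(36 / η)) * n) := by gcongr
          _ = n := by rw [← mul_assoc, ← Real.exp_add]; simp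
      have hL0 : 0 ≤ L := le_trans (by positivity) hL36
      refine (binomialRandom_real_upper_tail p Finset.inter_subset_left hL0 _).trans ?_
      rw [← Real.exp_nat_mul, Real.exp_le_exp, hexpL]
      have hcard : ((allPairs V ∩ U.sym2).card : ℝ) ≤ u ^ 2 := by
        have h2 : (allPairs V ∩ U.sym2).card ≤ U.card ^ 2 := by
          refine (Finset.card_le_card Finset.inter_subset_right).trans ?_
          rw [Finset.card_sym2, Nat.choose_two_right, Nat.add_sub_cancel]
          refine Nat.div_le_of_le_mul ?_
          have := hUn.card_pos
          nlinarith
        rw [hu]; exact_mod_cast h2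
      have h3 : (p : ℝ) * (allPairs V ∩ U.sym2).card * (n / u - 1) ≤ d * u := by
        have h4 : 0 ≤ n / u - 1 := by rw [sub_nonneg, one_le_div hu0]; exact hun
        calc (p : ℝ) * (allPairs V ∩ U.sym2).card * (n / u - 1) ≤ p * u ^ 2 * (n / u) := by
              gcongr
              linarith
          _ = d * u := by rw [hdd]; field_simp
      have h5 : 3 * d * u ≤ L * (m * u / 12) := by
        have h6 : 36 ≤ η * L := by rwa [div_le_iff₀' hη] at hL36
        have h7 : L * (η * d) ≤ L * m := mul_le_mul_of_nonneg_left hm hL0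
        have h8 : 36 * d ≤ L * m := by nlinarith
        nlinarith
      linarith
  refine h1.trans ?_
  have h2 : I ⊆ (Finset.univ : Finset V).powerset.erase ∅ := by
    intro U hU
    have : U.Nonempty ∧ U.card ≤ 6 * s := by simpa [hI] using hU
    simpa using this.1.ne_empty
  have h3 : ∑ U ∈ (Finset.univ : Finset V).powerset.erase ∅, Real.exp (-(2 * d)) ^ U.card + 1 ≤
      Real.exp (n * Real.exp (-(2 * d))) := by
    have h4 := sum_pow_card_powerset_le (Finset.univ : Finset V) (Real.exp_pos (-(2 * d))).le
    rw [← Finset.sum_erase_add _ _ (Finset.empty_mem_powerset _)] at h4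
    simpa using h4
  -- `log n ≤ d` gives `n ≤ exp d`, which absorbs the choice of vertices.
  have h5 : n * Real.exp (-(2 * d)) ≤ Real.exp (-d) := by
    rcases (Nat.cast_nonneg (Fintype.card V) : (0 : ℝ) ≤ _).eq_or_lt with h | h
    · rw [hn', ← h, zero_mul]
      exact (Real.exp_pos _).le
    · calc n * Real.exp (-(2 * d)) ≤ Real.exp d * Real.exp (-(2 * d)) := by
            gcongr
            rwa [← Real.log_le_iff_le_exp h]
        _ = Real.exp (-d) := by rw [← Real.exp_add]; congr 1; ring
  have h6 := Real.exp_le_exp.2 h5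
  have h7 := Finset.sum_le_sum_of_subset_of_nonneg h2
    (f := fun U : Finset V => Real.exp (-(2 * d)) ^ U.card) fun _ _ _ => by positivity
  linarith

end UnionBounds

/-! ### Low-degree vertices are scattered. -/

section UnionBounds

variable {V : Type*} [DecidableEq V]

theorem card_crossPairs {X Y : Finset V} (h : Disjoint X Y) :
    (crossPairs X Y).card = X.card * Y.card := by
  rw [crossPairs, Finset.card_image_of_injOn, Finset.card_product]
  rintro ⟨a, b⟩ hab ⟨c, d⟩ hcd heq
  simp only [Finset.coe_product, Set.mem_prod, Finset.mem_coe] at hab hcd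
  rcases Sym2.eq_iff.1 heq with ⟨h1, h2⟩ | ⟨h1, h2⟩
  · exact Prod.ext h1 h2
  · change a = d at h1
    subst h1
    exact absurd hcd.2 (Finset.disjoint_left.1 h hab.1)

variable [Fintype V] (p : unitInterval)

theorem crossPairs_subset_allPairs {X Y : Finset V} (h : Disjoint X Y) :
    crossPairs X Y ⊆ allPairs V := by
  intro e he
  obtain ⟨⟨x, y⟩, hxy, rfl⟩ := Finset.mem_image.1 he
  rw [Finset.mem_product] at hxy
  rw [mem_allPairs, Sym2.mk_isDiag_iff]
  intro hxy'
  change x = y at hxy'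
  subst hxy'
  exact Finset.disjoint_left.1 h hxy.1 hxy.2

theorem card_edges_inter_crossPairs_le (G : SimpleGraph V) {k : ℕ} {A Y : Finset V}
    (hA : ∀ a ∈ A, (G.nbrs a).card ≤ k) : (G.edges ∩ crossPairs A Y).card ≤ A.card * k := by
  have hsub : G.edges ∩ crossPairs A Y ⊆ A.biUnion fun a => (G.nbrs a).image fun w => s(a, w) := by
    intro e he
    obtain ⟨h1, h2⟩ := Finset.mem_inter.1 he
    obtain ⟨⟨x, y⟩, hxy, rfl⟩ := Finset.mem_image.1 h2
    exact Finset.mem_biUnion.2 ⟨x, (Finset.mem_product.1 hxy).1,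
      Finset.mem_image_of_mem _ (mem_nbrs.2 (mk_mem_edges.1 h1))⟩
  refine (Finset.card_le_card hsub).trans (Finset.card_biUnion_le_card_mul _ _ _ fun a ha => ?_)
  exact Finset.card_image_le.trans (hA a ha)

/-- The probability that a set `P` of pairs is present and the vertices of `A` have low degree. -/
theorem binomialRandom_real_subset_and_low_degree_le {U A : Finset V} {P : Finset (Sym2 V)}
    {m : ℕ} (hAU : A ⊆ U) (hU5 : U.card ≤ 5) (hA : A.Nonempty) (hA2 : A.card ≤ 2)
    (hP : P ⊆ allPairs V ∩ U.sym2) (hPc : P.card = U.card + 1 - A.card)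
    (hm : (m : ℝ) ≤ Fintype.card V * p / 4000)
    (hd : Real.log (Fintype.card V) ≤ Fintype.card V * p) (hd1 : 1 ≤ Fintype.card V * (p : ℝ)) :
    (binomialRandom V p).real {G | P ⊆ G.edges ∧
        ((G.edges ∩ crossPairs A Uᶜ).card : ℝ) ≤ A.card * (3 * m)} ≤
      (Fintype.card V * (p : ℝ)) ^ 5 * Real.exp (10 - 7 / 10 * (Fintype.card V * p)) *
        (Fintype.card V : ℝ)⁻¹ ^ U.card := by
  set n : ℝ := (Fintype.card V : ℝ) with hn'
  have hp0 : (0 : ℝ) ≤ p := p.2.1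
  have hp1 : (p : ℝ) ≤ 1 := p.2.2
  set d : ℝ := n * p with hdd
  have hn0 : 0 < n := by
    rcases (Nat.cast_nonneg (Fintype.card V) : (0 : ℝ) ≤ _).eq_or_lt with h | h
    · rw [hdd, hn', ← h] at hd1; norm_num at hd1
    · exact h
  have hnd : n ≤ Real.exp d := by rwa [← Real.log_le_iff_le_exp hn0]
  have hdisj : Disjoint A Uᶜ := by
    rw [Finset.disjoint_left]
    intro x hx hx'
    exact Finset.mem_compl.1 hx' (hAU hx)
  have hPF : Disjoint P (crossPairs A Uᶜ) := by
    rw [Finset.disjoint_left]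
    intro e he he'
    obtain ⟨⟨x, y⟩, hxy, rfl⟩ := Finset.mem_image.1 he'
    have h1 := (Finset.mem_inter.1 (hP he)).2
    rw [Finset.mk_mem_sym2_iff] at h1
    exact Finset.mem_compl.1 (Finset.mem_product.1 hxy).2 h1.2
  refine (binomialRandom_real_lower_tail p (hP.trans Finset.inter_subset_left)
    (crossPairs_subset_allPairs hdisj) hPF zero_le_two _).trans ?_
  have hF : ((crossPairs A Uᶜ).card : ℝ) = A.card * (n - U.card) := by
    rw [card_crossPairs hdisj, Finset.card_compl, Nat.cast_mul, Nat.cast_sub U.card_le_univ]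
  set u := U.card with hu
  have hu5 : (u : ℝ) ≤ 5 := by exact_mod_cast hU5
  have he2 : (86 / 100 : ℝ) ≤ 1 - Real.exp (-2) := by
    have h4 : Real.exp (-2) = Real.exp (-1) ^ 2 := by
      rw [← Real.exp_nat_mul]; norm_num
    have h5 := Real.exp_neg_one_lt_d9
    have h6 : Real.exp (-1) ^ 2 ≤ (0.37 : ℝ) ^ 2 :=
      pow_le_pow_left₀ (Real.exp_pos _).le (by linarith) 2
    rw [h4]
    norm_num at h6 ⊢
    linarith
  have hA1 : (1 : ℝ) ≤ A.card := by exact_mod_cast hA.card_pos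
  have hexp : Real.exp (2 * (A.card * (3 * m)) -
      p * (crossPairs A Uᶜ).card * (1 - Real.exp (-2))) ≤
      Real.exp (A.card * (5 - 85 / 100 * d)) := by
    rw [Real.exp_le_exp, hF]
    have h1 : d - 5 ≤ p * (n - u) := by
      have : (p : ℝ) * u ≤ 1 * 5 := mul_le_mul hp1 hu5 (Nat.cast_nonneg _) zero_le_one
      rw [hdd]; linarith
    have hun : (0 : ℝ) ≤ n - u := by
      rw [sub_nonneg, hn', hu]; exact_mod_cast U.card_le_univ
    have h2 : (p * (n - u)) * (86 / 100) ≤ (p * (n - u)) * (1 - Real.exp (-2)) :=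
      mul_le_mul_of_nonneg_left he2 (mul_nonneg hp0 hun)
    have h3 : 2 * (3 * (m : ℝ)) - (p * (n - u)) * (1 - Real.exp (-2)) ≤ 5 - 85 / 100 * d := by
      linarith
    calc _ = (A.card : ℝ) * (2 * (3 * (m : ℝ)) - (p * (n - u)) * (1 - Real.exp (-2))) := by ring
      _ ≤ _ := mul_le_mul_of_nonneg_left h3 (by linarith)
  have hAu : A.card ≤ u := Finset.card_le_card hAU
  -- Of the `u` factors `n`, all but `A.card - 1` pair with factors `p`; each unpaired one is at
  -- most `exp d`.
  have hpow : n ^ u * (p : ℝ) ^ P.card ≤ d ^ 5 * Real.exp (d * (A.card - 1)) := by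
    have h1 : u = (A.card - 1) + P.card := by
      have := hA.card_pos
      omega
    rw [h1, pow_add, mul_assoc, ← mul_pow, ← hdd, mul_comm]
    have h2 : d ^ P.card ≤ d ^ 5 := by
      refine pow_le_pow_right₀ hd1 ?_
      have := hA.card_pos
      omega
    have h3 : n ^ (A.card - 1) ≤ Real.exp (d * (A.card - 1)) := by
      have h4 : d * ((A.card : ℝ) - 1) = ((A.card - 1 : ℕ) : ℝ) * d := by
        rw [Nat.cast_sub hA.card_pos]; push_cast; ring
      rw [h4, Real.exp_nat_mul]
      exact pow_le_pow_left₀ hn0.le hnd _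
    exact mul_le_mul h2 h3 (by positivity) (by positivity)
  -- Two low-degree vertices gain `exp (-1.7 * d)` against one unpaired `exp d`; a single one has
  -- nothing to pay.
  have hfin : Real.exp (d * (A.card - 1)) * Real.exp (A.card * (5 - 85 / 100 * d)) ≤
      Real.exp (10 - 7 / 10 * d) := by
    rw [← Real.exp_add, Real.exp_le_exp]
    have : A.card = 1 ∨ A.card = 2 := by
      have := hA.card_pos
      omega
    rcases this with h | h <;> rw [h] <;> push_cast <;> linarith
  have hnu : 0 < n ^ u := by positivity
  rw [inv_pow, ← div_eq_mul_inv, le_div_iff₀ hnu]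
  calc _ ≤ (p : ℝ) ^ P.card * Real.exp (A.card * (5 - 85 / 100 * d)) * n ^ u := by
        gcongr
    _ = (n ^ u * (p : ℝ) ^ P.card) * Real.exp (A.card * (5 - 85 / 100 * d)) := by ring
    _ ≤ (d ^ 5 * Real.exp (d * (A.card - 1))) * Real.exp (A.card * (5 - 85 / 100 * d)) := by
        gcongr
    _ = d ^ 5 * (Real.exp (d * (A.card - 1)) * Real.exp (A.card * (5 - 85 / 100 * d))) := by ring
    _ ≤ d ^ 5 * Real.exp (10 - 7 / 10 * d) := by gcongr

theorem binomialRandom_real_not_lowDegreeScattered_le {m : ℕ}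
    (hm : (m : ℝ) ≤ Fintype.card V * p / 4000)
    (hd : Real.log (Fintype.card V) ≤ Fintype.card V * p) (hd1 : 1 ≤ Fintype.card V * (p : ℝ)) :
    (binomialRandom V p).real {G | ¬ G.LowDegreeScattered (3 * m)} ≤
      2 ^ 20 * Real.exp 1 *
        ((Fintype.card V * (p : ℝ)) ^ 5 * Real.exp (10 - 7 / 10 * (Fintype.card V * p))) := by
  classical
  set n : ℝ := (Fintype.card V : ℝ) with hn'
  set b : ℝ := (n * p) ^ 5 * Real.exp (10 - 7 / 10 * (n * p)) with hb
  have hn0 : 0 ≤ n := Nat.cast_nonneg _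
  have hb0 : 0 ≤ b := by
    have : (0 : ℝ) ≤ p := p.2.1
    positivity
  set I : Finset (Finset V) := Finset.univ.filter fun U => U.card ≤ 5 with hI
  set J : Finset V → Finset (Finset V × Finset (Sym2 V)) := fun U =>
    (U.powerset ×ˢ (allPairs V ∩ U.sym2).powerset).filter fun q =>
      q.1.Nonempty ∧ q.1.card ≤ 2 ∧ q.2.card = U.card + 1 - q.1.card with hJ
  have h1 : (binomialRandom V p).real {G | ¬ G.LowDegreeScattered (3 * m)} ≤
      ∑ x ∈ I.sigma J, b * n⁻¹ ^ x.1.card := by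
    refine binomialRandom_real_le_sum_of_subset p (I.sigma J)
      (fun x => {G | x.2.2 ⊆ G.edges ∧
        ((G.edges ∩ crossPairs x.2.1 x.1ᶜ).card : ℝ) ≤ x.2.1.card * (3 * m)}) ?_ ?_
    · intro G hG
      simp only [LowDegreeScattered, Set.mem_ofPred_eq, not_forall, not_le] at hG
      obtain ⟨U, A, hAU, hU5, hA, hA2, hdeg, hlt⟩ := hG
      obtain ⟨P, hP, hPc⟩ := Finset.exists_subset_card_eq
        (show U.card + 1 - A.card ≤ (G.edges ∩ U.sym2).card by omega)
      refine ⟨⟨U, A, P⟩, ?_, ?_⟩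
      · simp only [hI, hJ, Finset.mem_sigma, Finset.mem_filter, Finset.mem_univ, true_and,
          Finset.mem_product, Finset.mem_powerset]
        refine ⟨hU5, ⟨hAU, hP.trans (Finset.inter_subset_inter_right G.edges_subset_allPairs)⟩,
          hA, hA2, hPc⟩
      · refine ⟨hP.trans Finset.inter_subset_left, ?_⟩
        exact_mod_cast G.card_edges_inter_crossPairs_le fun a ha => (hdeg a ha).le
    · rintro ⟨U, A, P⟩ hx
      simp only [hI, hJ, Finset.mem_sigma, Finset.mem_filter, Finset.mem_univ, true_and,
        Finset.mem_product, Finset.mem_powerset] at hx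
      obtain ⟨hU5, ⟨hAU, hP⟩, hA, hA2, hPc⟩ := hx
      exact binomialRandom_real_subset_and_low_degree_le p hAU hU5 hA hA2 hP hPc hm hd hd1
  refine h1.trans ?_
  rw [Finset.sum_sigma]
  have h2 : ∀ U ∈ I, ∑ _q ∈ J U, b * n⁻¹ ^ U.card ≤ 2 ^ 20 * b * n⁻¹ ^ U.card := by
    intro U hU
    have hU5 : U.card ≤ 5 := by simpa [hI] using hU
    rw [Finset.sum_const, nsmul_eq_mul, mul_assoc (2 ^ 20)]
    -- At most `2 ^ 5` choices of `A` and, with at most 15 unordered pairs (diagonal included), `2 ^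
    -- 15` choices of `P`.
    have h3 : (J U).card ≤ 2 ^ 20 := by
      refine (Finset.card_filter_le _ _).trans ?_
      rw [Finset.card_product, Finset.card_powerset, Finset.card_powerset, ← pow_add]
      refine Nat.pow_le_pow_right (by norm_num) ?_
      have h4 : (allPairs V ∩ U.sym2).card ≤ 15 := by
        refine (Finset.card_le_card Finset.inter_subset_right).trans ?_
        rw [Finset.card_sym2]
        exact Nat.choose_le_choose 2 (show U.card + 1 ≤ 6 by omega)
      omega
    have h4 : ((J U).card : ℝ) ≤ 2 ^ 20 := by exact_mod_cast h3
    exact mul_le_mul_of_nonneg_right h4 (mul_nonneg hb0 (pow_nonneg (inv_nonneg.2 hn0) _))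
  refine (Finset.sum_le_sum h2).trans ?_
  rw [← Finset.mul_sum]
  have h5 : ∑ U ∈ I, n⁻¹ ^ U.card ≤ Real.exp 1 := by
    calc ∑ U ∈ I, n⁻¹ ^ U.card ≤ ∑ U ∈ (Finset.univ : Finset V).powerset, n⁻¹ ^ U.card :=
          Finset.sum_le_sum_of_subset_of_nonneg (fun U _ => by simp)
            fun _ _ _ => pow_nonneg (inv_nonneg.2 hn0) _
      _ ≤ Real.exp ((Finset.univ : Finset V).card * n⁻¹) :=
          sum_pow_card_powerset_le _ (by positivity)
      _ ≤ Real.exp 1 := by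
          rw [Real.exp_le_exp, Finset.card_univ]
          exact mul_inv_le_one
  calc _ ≤ 2 ^ 20 * b * Real.exp 1 := mul_le_mul_of_nonneg_left h5 (by positivity)
    _ = _ := by ring

end UnionBounds

/-! ### Joined sets, edge counts and degrees. -/

section UnionBounds

variable {V : Type*} [Fintype V] [DecidableEq V] (p : unitInterval)

theorem edges_inf (G T : SimpleGraph V) : (G ⊓ T).edges = G.edges ∩ T.edges := by
  ext e
  simp [mem_edges]

theorem binomialRandom_real_not_denselyJoined_le (T : SimpleGraph V) {s k : ℕ} {f : ℝ}
    (hT : ∀ X Y : Finset V, Disjoint X Y → s ≤ X.card → Fintype.card V ≤ 4 * Y.card →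
      f ≤ ((T.edges ∩ crossPairs X Y).card : ℝ)) :
    (binomialRandom V p).real {G | ¬ (G ⊓ T).DenselyJoined s k} ≤
      4 ^ Fintype.card V * Real.exp (k - p * f / 2) := by
  classical
  have hp0 : (0 : ℝ) ≤ p := p.2.1
  set I : Finset (Finset V × Finset V) := Finset.univ.filter fun q =>
    Disjoint q.1 q.2 ∧ s ≤ q.1.card ∧ Fintype.card V ≤ 4 * q.2.card with hI
  have h1 : (binomialRandom V p).real {G | ¬ (G ⊓ T).DenselyJoined s k} ≤
      ∑ _q ∈ I, Real.exp (k - p * f / 2) := by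
    refine binomialRandom_real_le_sum_of_subset p I
      (fun q => {G | ∅ ⊆ G.edges ∧
        ((G.edges ∩ (T.edges ∩ crossPairs q.1 q.2)).card : ℝ) ≤ k}) ?_ ?_
    · intro G hG
      simp only [DenselyJoined, Set.mem_ofPred_eq, not_forall, not_lt] at hG
      obtain ⟨X, Y, h1, h2, h3, h4⟩ := hG
      refine ⟨⟨X, Y⟩, by simp [hI, h1, h2, h3], Finset.empty_subset _, ?_⟩
      rw [← Finset.inter_assoc, ← edges_inf]
      exact_mod_cast h4
    · rintro ⟨X, Y⟩ hq
      obtain ⟨h1, h2, h3⟩ : Disjoint X Y ∧ s ≤ X.card ∧ Fintype.card V ≤ 4 * Y.card := by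
        simpa [hI] using hq
      refine (binomialRandom_real_lower_tail p (Finset.empty_subset _)
        (Finset.inter_subset_left.trans T.edges_subset_allPairs)
        (Finset.disjoint_empty_left _) zero_le_one _).trans ?_
      rw [Finset.card_empty, pow_zero, one_mul, Real.exp_le_exp]
      have h4 := hT X Y h1 h2 h3
      have h5 : (p : ℝ) * f * (1 / 2) ≤
          p * (T.edges ∩ crossPairs X Y).card * (1 - Real.exp (-1)) := by
        refine (mul_le_mul_of_nonneg_right (mul_le_mul_of_nonneg_left h4 hp0)
          (by norm_num)).trans ?_
        exact mul_le_mul_of_nonneg_left half_le_one_sub_exp_neg_one (by positivity)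
      simp only
      linarith
  refine h1.trans ?_
  rw [Finset.sum_const, nsmul_eq_mul]
  refine mul_le_mul_of_nonneg_right ?_ (Real.exp_pos _).le
  have h2 : I.card ≤ 4 ^ Fintype.card V := by
    refine (Finset.card_filter_le _ _).trans ?_
    rw [Finset.card_univ, Fintype.card_prod, Fintype.card_finset, ← mul_pow]
    norm_num
  exact_mod_cast h2

theorem binomialRandom_real_le_card_edges_inf (T : SimpleGraph V)
    (hT : (T.edges.card : ℝ) ≤ (Fintype.card V : ℝ) ^ 2 / 8000) :
    (binomialRandom V p).real {G | (Fintype.card V : ℝ) ^ 2 * p / 4000 ≤ ((G ⊓ T).edges.card : ℝ)} ≤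
      Real.exp (-((Fintype.card V : ℝ) ^ 2 * p / 40000)) := by
  have hp0 : (0 : ℝ) ≤ p := p.2.1
  simp_rw [edges_inf]
  refine (binomialRandom_real_upper_tail p T.edges_subset_allPairs zero_le_one _).trans ?_
  rw [Real.exp_le_exp]
  have h1 : Real.exp 1 - 1 ≤ 1.72 := by linarith [Real.exp_one_lt_d9]
  have h2 : 0 ≤ Real.exp 1 - 1 := by linarith [Real.exp_one_gt_d9]
  have h3 : (p : ℝ) * T.edges.card * (Real.exp 1 - 1) ≤
      p * ((Fintype.card V : ℝ) ^ 2 / 8000) * 1.72 := by gcongr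
  have h4 : 0 ≤ (Fintype.card V : ℝ) ^ 2 * p := by positivity
  linarith

theorem binomialRandom_real_le_card_edges :
    (binomialRandom V p).real {G | (Fintype.card V : ℝ) ^ 2 * p ≤ (G.edges.card : ℝ)} ≤
      Real.exp (-((Fintype.card V : ℝ) ^ 2 * p / 10)) := by
  have hp0 : (0 : ℝ) ≤ p := p.2.1
  have h := binomialRandom_real_upper_tail p (Finset.Subset.refl (allPairs V)) zero_le_one
    ((Fintype.card V : ℝ) ^ 2 * p)
  simp_rw [Finset.inter_eq_left.2 (edges_subset_allPairs _)] at h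
  refine h.trans ?_
  rw [Real.exp_le_exp]
  have h1 : Real.exp 1 - 1 ≤ 1.72 := by linarith [Real.exp_one_lt_d9]
  have h2 : 0 ≤ Real.exp 1 - 1 := by linarith [Real.exp_one_gt_d9]
  have h3 : (p : ℝ) * (allPairs V).card * (Real.exp 1 - 1) ≤
      p * ((Fintype.card V : ℝ) ^ 2 / 2) * 1.72 := by
    have := card_allPairs_le (V := V)
    gcongr
  have h4 : 0 ≤ (Fintype.card V : ℝ) ^ 2 * p := by positivity
  linarith

theorem disjoint_singleton_compl (v : V) : Disjoint ({v} : Finset V) {v}ᶜ := disjoint_compl_right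

theorem card_crossPairs_singleton_compl (v : V) :
    ((crossPairs {v} {v}ᶜ).card : ℝ) = Fintype.card V - 1 := by
  rw [card_crossPairs (disjoint_singleton_compl v), Finset.card_singleton, one_mul,
    Finset.card_compl, Finset.card_singleton,
    Nat.cast_sub (Fintype.card_pos_iff.2 ⟨v⟩), Nat.cast_one]

theorem card_nbrs_le_card_inter_crossPairs (G : SimpleGraph V) (v : V) :
    (G.nbrs v).card ≤ (G.edges ∩ crossPairs {v} {v}ᶜ).card := by
  rw [card_nbrs_eq]
  refine Finset.card_le_card (Finset.subset_inter (G.image_nbrs_subset_edges v) fun e he => ?_)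
  obtain ⟨w, hw, rfl⟩ := Finset.mem_image.1 he
  refine Finset.mem_image.2 ⟨(v, w), Finset.mem_product.2 ⟨by simp, ?_⟩, rfl⟩
  simpa using (mem_nbrs.1 hw).ne'

theorem binomialRandom_real_le_card_nbrs (v : V) :
    (binomialRandom V p).real {G | 3 * (Fintype.card V * (p : ℝ)) ≤ ((G.nbrs v).card : ℝ)} ≤
      Real.exp (-(Fintype.card V * (p : ℝ))) := by
  have hp0 : (0 : ℝ) ≤ p := p.2.1
  have h := binomialRandom_real_upper_tail p
    (crossPairs_subset_allPairs (disjoint_singleton_compl v)) zero_le_one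
    (3 * (Fintype.card V * (p : ℝ)))
  refine (MeasureTheory.measureReal_mono (fun G hG => ?_)
    (MeasureTheory.measure_ne_top _ _)).trans (h.trans ?_)
  · rw [Set.mem_ofPred_eq] at hG ⊢
    refine le_trans hG ?_
    exact_mod_cast G.card_nbrs_le_card_inter_crossPairs v
  · rw [Real.exp_le_exp, card_crossPairs_singleton_compl]
    have h1 : Real.exp 1 - 1 ≤ 2 := by linarith [Real.exp_one_lt_d9]
    have h2 : 0 ≤ Real.exp 1 - 1 := by linarith [Real.exp_one_gt_d9]
    have h3 : (p : ℝ) * (Fintype.card V - 1) * (Real.exp 1 - 1) ≤ p * Fintype.card V * 2 := by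
      gcongr
      linarith
    linarith

theorem binomialRandom_real_exists_isolated_le (hn : 0 < Fintype.card V) :
    (binomialRandom V p).real {G | ∃ v, (G.nbrs v).card = 0} ≤
      Real.exp (2 - (Fintype.card V * (p : ℝ) - Real.log (Fintype.card V))) := by
  set n : ℝ := (Fintype.card V : ℝ) with hn'
  have hn1 : 1 ≤ n := by rw [hn']; exact_mod_cast hn
  have hp0 : (0 : ℝ) ≤ p := p.2.1
  have hp1 : (p : ℝ) ≤ 1 := p.2.2
  have h1 : (binomialRandom V p).real {G | ∃ v, (G.nbrs v).card = 0} ≤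
      ∑ _v : V, Real.exp (2 - n * p) := by
    refine binomialRandom_real_le_sum_of_subset p Finset.univ
      (fun v => {G | ∅ ⊆ G.edges ∧ ((G.edges ∩ crossPairs {v} {v}ᶜ).card : ℝ) ≤ 0}) ?_ ?_
    · rintro G ⟨v, hv⟩
      refine ⟨v, Finset.mem_univ v, Finset.empty_subset _, ?_⟩
      have := G.card_edges_inter_crossPairs_le (k := 0) (A := {v}) (Y := {v}ᶜ)
        (by simpa using hv)
      exact_mod_cast this
    · intro v _
      refine (binomialRandom_real_lower_tail p (Finset.empty_subset _)
        (crossPairs_subset_allPairs (disjoint_singleton_compl v))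
        -- With target 0 a larger Chernoff parameter only helps; `log n` loses merely the constant 2
        -- in the exponent.
        (Finset.disjoint_empty_left _) (Real.log_nonneg hn1) 0).trans ?_
      rw [Finset.card_empty, pow_zero, one_mul, Real.exp_le_exp, card_crossPairs_singleton_compl,
        Real.exp_neg, Real.exp_log (by linarith)]
      have h2 : (n - 1) * (1 - n⁻¹) = n - 2 + n⁻¹ := by
        field_simp
        ring
      have h3 : 0 ≤ n⁻¹ := by positivity
      have h4 : (p : ℝ) * (n - 1) * (1 - n⁻¹) = n * p - 2 * p + p * n⁻¹ := by
        rw [mul_assoc, h2]; ring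
      have h5 : 0 ≤ (p : ℝ) * n⁻¹ := mul_nonneg hp0 h3
      rw [← hn', h4]
      linarith
  refine h1.trans_eq ?_
  rw [Finset.sum_const, Finset.card_univ, nsmul_eq_mul, ← hn']
  nth_rewrite 1 [← Real.exp_log (by linarith : 0 < n)]
  rw [← Real.exp_add]
  congr 1
  ring

end UnionBounds

/-! ### The template, the choice of parameters and the limit. -/

theorem tendsto_four_pow_mul_exp_neg_sq {c : ℝ} (hc : 0 < c) :
    Tendsto (fun n : ℕ => (4 : ℝ) ^ n * Real.exp (-(c * (n : ℝ) ^ 2))) atTop (𝓝 0) := by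
  have h : Tendsto (fun n : ℕ => Real.exp (-(n : ℝ))) atTop (𝓝 0) :=
    Real.tendsto_exp_neg_atTop_nhds_zero.comp tendsto_natCast_atTop_atTop
  refine squeeze_zero' (Eventually.of_forall fun n => by positivity) ?_ h
  filter_upwards [tendsto_natCast_atTop_atTop.eventually_ge_atTop (4 / c)] with n hn
  rw [div_le_iff₀ hc] at hn
  have h4 : (4 : ℝ) ^ n ≤ Real.exp (3 * n) := by
    rw [mul_comm, Real.exp_nat_mul]
    exact pow_le_pow_left₀ (by norm_num) (by linarith [Real.add_one_le_exp (3 : ℝ)]) n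
  calc _ ≤ Real.exp (3 * n) * Real.exp (-(c * (n : ℝ) ^ 2)) := by gcongr
    _ ≤ Real.exp (-(n : ℝ)) := by
        rw [← Real.exp_add, Real.exp_le_exp]
        have : (0 : ℝ) ≤ n := Nat.cast_nonneg n
        nlinarith

/-- There are sparse graphs in which all large disjoint sets are joined by many edges. -/
theorem eventually_exists_template {β : ℝ} (hβ : 0 < β) :
    ∀ᶠ n : ℕ in atTop, ∀ s : ℕ, β * n ≤ s → ∃ T : SimpleGraph (Fin n),
      (T.edges.card : ℝ) ≤ (n : ℝ) ^ 2 / 8000 ∧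
      ∀ X Y : Finset (Fin n), Disjoint X Y → s ≤ X.card → n ≤ 4 * Y.card →
        β * (n : ℝ) ^ 2 / 128000 ≤ ((T.edges ∩ crossPairs X Y).card : ℝ) := by
  have h1 := (tendsto_four_pow_mul_exp_neg_sq
    (show 0 < β / 128000 by positivity)).eventually_lt_const (show (0 : ℝ) < 1 / 2 by norm_num)
  have h2 := (tendsto_four_pow_mul_exp_neg_sq
    (show (0 : ℝ) < 1 / 80000 by norm_num)).eventually_lt_const (show (0 : ℝ) < 1 / 2 by norm_num)
  filter_upwards [h1, h2] with n h1 h2 s hs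
  -- Probabilistic method: a random graph of density `q` fails each of the two requirements with
  -- probability below `1 / 2`.
  set q : unitInterval := ⟨1 / 8000, by norm_num, by norm_num⟩ with hq
  have hqv : (q : ℝ) = 1 / 8000 := rfl
  set k : ℕ := ⌊β * (n : ℝ) ^ 2 / 128000⌋₊ with hk
  have h3 := binomialRandom_real_not_denselyJoined_le q (⊤ : SimpleGraph (Fin n)) (s := s) (k := k)
    (f := β * (n : ℝ) ^ 2 / 4) (by
      intro X Y hXY hX hY
      have hsub : crossPairs X Y ⊆ (⊤ : SimpleGraph (Fin n)).edges := fun e he => by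
        have := mem_allPairs.1 (crossPairs_subset_allPairs hXY he)
        simpa [mem_edges] using this
      rw [Finset.inter_eq_right.2 hsub, card_crossPairs hXY]
      rw [Fintype.card_fin] at hY
      have hX' : β * n ≤ (X.card : ℝ) := hs.trans (by exact_mod_cast hX)
      have hY' : (n : ℝ) ≤ 4 * Y.card := by exact_mod_cast hY
      push_cast
      have : (β * n) * (n / 4) ≤ (X.card : ℝ) * Y.card :=
        mul_le_mul hX' (by linarith) (by positivity) (Nat.cast_nonneg _)
      linarith)
  have h4 := binomialRandom_real_le_card_edges (V := Fin n) q
  rw [Fintype.card_fin] at h3 h4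
  simp_rw [inf_top_eq] at h3
  have hkle : (k : ℝ) ≤ β * (n : ℝ) ^ 2 / 128000 := Nat.floor_le (by positivity)
  have h5 : (binomialRandom (Fin n) q).real {G | ¬ G.DenselyJoined s k} < 1 / 2 := by
    refine h3.trans_lt (lt_of_le_of_lt ?_ h1)
    gcongr
    rw [hqv]
    linarith
  have h6 : (binomialRandom (Fin n) q).real {G | (n : ℝ) ^ 2 * q ≤ (G.edges.card : ℝ)} < 1 / 2 := by
    refine h4.trans_lt (lt_of_le_of_lt ?_ h2)
    rw [hqv]
    refine le_trans (le_of_eq ?_) (le_mul_of_one_le_left (Real.exp_pos _).le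
      (one_le_pow₀ (by norm_num)))
    congr 1
    ring
  have h7 : ∃ T : SimpleGraph (Fin n), T ∉ {G : SimpleGraph (Fin n) | ¬ G.DenselyJoined s k} ∪
      {G | (n : ℝ) ^ 2 * q ≤ (G.edges.card : ℝ)} := by
    by_contra! hcon
    have h8 := MeasureTheory.measureReal_union_le (μ := binomialRandom (Fin n) q)
      {G : SimpleGraph (Fin n) | ¬ G.DenselyJoined s k}
      {G | (n : ℝ) ^ 2 * q ≤ (G.edges.card : ℝ)}
    rw [Set.eq_univ_of_forall hcon, MeasureTheory.probReal_univ] at h8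
    linarith
  obtain ⟨T, hT⟩ := h7
  simp only [Set.mem_union, Set.mem_ofPred_eq, not_or, not_not, not_le] at hT
  refine ⟨T, ?_, fun X Y hXY hX hY => ?_⟩
  · rw [hqv] at hT
    linarith [hT.2]
  · have := hT.1 X Y hXY hX (by rwa [Fintype.card_fin])
    exact (Nat.lt_of_floor_lt this).le

theorem card_nbrs_eq_degree {V : Type*} [Fintype V] (G : SimpleGraph V) [DecidableRel G.Adj]
    (v : V) : (G.nbrs v).card = G.degree v := by
  rw [← card_neighborFinset_eq_degree]
  congr 1
  ext w
  simp [mem_nbrs]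

/-- The degree of one arbitrary vertex `v₀` bounds the minimum degree by `k`. Excluding isolated
vertices is enough: for minimum degree 1 both sides are 0. -/
theorem ResilienceWitness.globalResilience_eq_minDegree_sub_one {V : Type*} [Fintype V]
    [DecidableEq V] {G T : SimpleGraph V} [DecidableRel G.Adj] {m s M k : ℕ}
    (hG : G.ResilienceWitness T m s M k) (h3 : 3 ≤ Fintype.card V) (hm : 2 ≤ m) {v₀ : V}
    (hk : (G.nbrs v₀).card ≤ k) (hpos : ∀ v, (G.nbrs v).card ≠ 0) :
    (globalResilience (fun G' : SimpleGraph V => G'.IsHamiltonian) G : ℤ) = G.minDegree - 1 := by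
  have : Nonempty V := ⟨v₀⟩
  obtain ⟨v, hv⟩ := G.exists_minimal_degree_vertex
  have hmin : ∀ w, (G.nbrs v).card ≤ (G.nbrs w).card := by
    intro w
    rw [card_nbrs_eq_degree, card_nbrs_eq_degree, ← hv]
    exact G.minDegree_le_degree w
  have h := hG.globalResilience_eq h3 hm hmin ((hmin v₀).trans hk) (Nat.pos_of_ne_zero (hpos v))
  rw [h, hv, ← card_nbrs_eq_degree]
  have := hpos v
  omega

/-- The parameters for which a random graph with expected degree `d` is resilient. -/
theorem ResilienceWitness.of_params {n : ℕ} {p : unitInterval} {G T : SimpleGraph (Fin n)}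
    {m s k : ℕ} (hm : (m : ℝ) ≤ n * p / 4000) (hd : 8000 ≤ n * (p : ℝ)) (hs : 4 * s ≤ n)
    (h1 : G.HasBoosters ⌊(n : ℝ) ^ 2 * p / 1000⌋₊ k) (h2 : G.LocallySparse m s)
    (h3 : G.LowDegreeScattered (3 * m)) (h4 : (G ⊓ T).DenselyJoined s k)
    (h5 : ((G ⊓ T).edges.card : ℝ) < (n : ℝ) ^ 2 * p / 4000) :
    G.ResilienceWitness T m s ⌊(n : ℝ) ^ 2 * p / 1000⌋₊ k where
  sparse := h2
  scattered := h3
  joined := h4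
  boosters := h1
  four_mul_le := by rwa [Fintype.card_fin]
  card_edges_le := by
    rw [Fintype.card_fin]
    refine Nat.le_floor ?_
    push_cast
    have hn : (0 : ℝ) ≤ n := Nat.cast_nonneg n
    have h6 : (n : ℝ) * m ≤ n * (n * p / 4000) := mul_le_mul_of_nonneg_left hm hn
    have h7 : (n : ℝ) * 8000 ≤ n * (n * p) := mul_le_mul_of_nonneg_left hd hn
    have h8 : (n : ℝ) * (n * p) = n ^ 2 * p := by ring
    linarith

/-- An upper bound for the probability that the resilience differs from the minimum degree
minus one. -/
noncomputable def failureBound (n d : ℝ) : ℝ :=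
  4 * Real.exp (-d) + (Real.exp (Real.exp (-d)) - 1) +
    2 ^ 20 * Real.exp 1 * (d ^ 5 * Real.exp (10 - 7 / 10 * d)) + Real.exp (2 - (d - Real.log n))

theorem tendsto_failureBound {d : ℕ → ℝ} (hd : Tendsto d atTop atTop)
    (hdn : Tendsto (fun n : ℕ => d n - Real.log n) atTop atTop) :
    Tendsto (fun n : ℕ => failureBound n (d n)) atTop (𝓝 0) := by
  have h1 : Tendsto (fun n => Real.exp (-(d n))) atTop (𝓝 0) :=
    Real.tendsto_exp_neg_atTop_nhds_zero.comp hd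
  have h2 : Tendsto (fun n => Real.exp (Real.exp (-(d n))) - 1) atTop (𝓝 0) := by
    have := ((Real.continuous_exp.tendsto 0).comp h1).sub_const 1
    simpa using this
  have h3 : Tendsto (fun n => d n ^ 5 * Real.exp (10 - 7 / 10 * d n)) atTop (𝓝 0) := by
    have h := (Real.tendsto_pow_mul_exp_neg_atTop_nhds_zero 5).comp
      (hd.const_mul_atTop (show (0 : ℝ) < 7 / 10 by norm_num))
    have h' := h.const_mul ((10 / 7) ^ 5 * Real.exp 10)
    rw [mul_zero] at h'
    refine h'.congr fun n => ?_
    simp only [Function.comp_apply]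
    rw [sub_eq_add_neg 10, Real.exp_add]
    ring
  have h4 : Tendsto (fun n : ℕ => Real.exp (2 - (d n - Real.log n))) atTop (𝓝 0) :=
    Real.tendsto_exp_atBot.comp (tendsto_atBot_add_const_left _ _ (tendsto_neg_atTop_atBot.comp hdn))
  simpa [failureBound] using
    (((h1.const_mul 4).add h2).add (h3.const_mul (2 ^ 20 * Real.exp 1))).add h4

theorem eventually_binomialRandom_real_le {p : ℕ → unitInterval}
    (hd : Tendsto (fun n : ℕ => (n : ℝ) * (p n : ℝ)) atTop atTop)
    (hdn : ∀ᶠ n : ℕ in atTop, Real.log n ≤ n * (p n : ℝ)) :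
    ∀ᶠ n : ℕ in atTop, (binomialRandom (Fin n) (p n)).real
      {G : SimpleGraph (Fin n) |
        ¬ (globalResilience (fun G' : SimpleGraph (Fin n) => G'.IsHamiltonian) G : ℤ) =
            (@SimpleGraph.minDegree (Fin n) G _ (Classical.decRel G.Adj) : ℤ) - 1} ≤
      failureBound n (n * (p n : ℝ)) := by
  -- `γ` is the local sparsity threshold for `η = 1 / 8000`. Taking `β = γ / 12` leaves room for
  -- rounding in `6 * s ≤ γ * n`.
  obtain ⟨γ, hγ⟩ : ∃ γ : ℝ, γ = Real.exp (-(36 / (1 / 8000))) := ⟨_, rfl⟩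
  have hγ0 : 0 < γ := hγ ▸ Real.exp_pos _
  have hγ1 : γ ≤ 1 := by
    rw [hγ, Real.exp_le_one_iff]
    norm_num
  obtain ⟨β, hβ⟩ : ∃ β : ℝ, β = γ / 12 := ⟨_, rfl⟩
  have hβ0 : 0 < β := by rw [hβ]; positivity
  filter_upwards [eventually_exists_template hβ0, hd.eventually_ge_atTop 16000,
    hd.eventually_ge_atTop (1536000 / β), hdn,
    tendsto_natCast_atTop_atTop.eventually_ge_atTop (2560000 / β),
    tendsto_natCast_atTop_atTop.eventually_ge_atTop (1 / β),
    eventually_ge_atTop 40000] with n hT hd1 hd2 hlog hn1 hn2 hn3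
  obtain ⟨q, hq⟩ : ∃ q, q = p n := ⟨_, rfl⟩
  rw [← hq] at hd1 hd2 hlog ⊢
  have hq0 : (0 : ℝ) ≤ q := q.2.1
  obtain ⟨d, hdd⟩ : ∃ d : ℝ, d = n * (q : ℝ) := ⟨_, rfl⟩
  have hsq : (n : ℝ) ^ 2 * q = n * d := by rw [hdd]; ring
  rw [← hdd] at hd1 hd2 hlog ⊢
  have hd0 : 0 < d := by linarith
  have hnr : (40000 : ℝ) ≤ n := by exact_mod_cast hn3
  rw [div_le_iff₀ hβ0] at hd2 hn1 hn2
  obtain ⟨s, hs⟩ : ∃ s : ℕ, s = ⌈β * n⌉₊ := ⟨_, rfl⟩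
  have hs1 : β * n ≤ s := hs ▸ Nat.le_ceil _
  have hs2 : 6 * (s : ℝ) ≤ γ * n := by
    have : (s : ℝ) < β * n + 1 := hs ▸ Nat.ceil_lt_add_one (by positivity)
    have : 12 * (β * n) = γ * n := by rw [hβ]; ring
    linarith
  have hs4 : 4 * s ≤ n := by
    have : 6 * (s : ℝ) ≤ n := hs2.trans (mul_le_of_le_one_left (Nat.cast_nonneg n) hγ1)
    have : 6 * s ≤ n := by exact_mod_cast this
    omega
  obtain ⟨T, hT1, hT2⟩ := hT s hs1
  obtain ⟨m, hm⟩ : ∃ m : ℕ, m = ⌈d / 8000⌉₊ := ⟨_, rfl⟩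
  have hm1 : d / 8000 ≤ m := hm ▸ Nat.le_ceil _
  have hm2 : (m : ℝ) ≤ d / 4000 := by
    have : (m : ℝ) < d / 8000 + 1 := hm ▸ Nat.ceil_lt_add_one (by positivity)
    linarith
  have hm3 : 2 ≤ m := by
    have : (2 : ℝ) ≤ m := by linarith
    exact_mod_cast this
  obtain ⟨k, hk⟩ : ∃ k : ℕ, k = ⌈3 * d⌉₊ := ⟨_, rfl⟩
  have hk1 : 3 * d ≤ k := hk ▸ Nat.le_ceil _
  have hk2 : (k : ℝ) ≤ 4 * d := by
    have : (k : ℝ) < 3 * d + 1 := hk ▸ Nat.ceil_lt_add_one (by positivity)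
    linarith
  obtain ⟨M, hM⟩ : ∃ M : ℕ, M = ⌊(n : ℝ) ^ 2 * q / 1000⌋₊ := ⟨_, rfl⟩
  have hM1 : (M : ℝ) ≤ (n : ℝ) ^ 2 * q / 1000 := hM ▸ Nat.floor_le (by positivity)
  have hcard : Fintype.card (Fin n) = n := Fintype.card_fin n
  let v₀ : Fin n := ⟨0, by omega⟩
  set μ := binomialRandom (Fin n) q with hμ
  have b1 : μ.real {G | ¬ G.HasBoosters M k} ≤ Real.exp (-d) := by
    refine (binomialRandom_real_not_hasBoosters_le q (by omega) (by rwa [hcard])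
      (by rwa [hcard, ← hdd])).trans ?_
    rw [hcard, hsq, Real.exp_le_exp]
    nlinarith
  have b2 : μ.real {G | ¬ G.LocallySparse m s} ≤ Real.exp (Real.exp (-d)) - 1 := by
    have := binomialRandom_real_not_locallySparse_le q (m := m) (s := s) (V := Fin n)
      (show (0 : ℝ) < 1 / 8000 by norm_num) (by rw [hcard, ← hdd]; linarith)
      (by rwa [hcard, ← hγ]) (by rwa [hcard, ← hdd])
    rwa [hcard, ← hdd] at this
  have b3 : μ.real {G | ¬ G.LowDegreeScattered (3 * m)} ≤
      2 ^ 20 * Real.exp 1 * (d ^ 5 * Real.exp (10 - 7 / 10 * d)) := by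
    have := binomialRandom_real_not_lowDegreeScattered_le q (m := m) (V := Fin n)
      (by rwa [hcard, ← hdd]) (by rwa [hcard, ← hdd]) (by rw [hcard, ← hdd]; linarith)
    rwa [hcard, ← hdd] at this
  have b4 : μ.real {G | ¬ (G ⊓ T).DenselyJoined s k} ≤ Real.exp (-d) := by
    refine (binomialRandom_real_not_denselyJoined_le q T (s := s) (k := k)
      (f := β * (n : ℝ) ^ 2 / 128000) (by simpa only [hcard] using hT2)).trans ?_
    rw [hcard]
    have h4 : (4 : ℝ) ^ n ≤ Real.exp (3 * n) := by
      rw [mul_comm, Real.exp_nat_mul]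
      exact pow_le_pow_left₀ (by norm_num) (by linarith [Real.add_one_le_exp (3 : ℝ)]) n
    calc _ ≤ Real.exp (3 * n) * Real.exp (k - q * (β * (n : ℝ) ^ 2 / 128000) / 2) := by gcongr
      _ ≤ Real.exp (-d) := by
        rw [← Real.exp_add, Real.exp_le_exp]
        -- The exponent is split in two equal halves: one beats `3 * n` from `4 ^ n` (`1536000 = 3 *
        -- 512000`), the other beats `k + d ≤ 5 * d` (`2560000 = 5 * 512000`).
        have h5 : (q : ℝ) * (β * (n : ℝ) ^ 2 / 128000) / 2 = n * (d * β) / 512000 +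
            d * (n * β) / 512000 := by rw [hdd]; ring
        have h6 : (n : ℝ) * 1536000 ≤ n * (d * β) :=
          mul_le_mul_of_nonneg_left hd2 (Nat.cast_nonneg n)
        have h7 : d * 2560000 ≤ d * (n * β) := mul_le_mul_of_nonneg_left hn1 hd0.le
        rw [h5]
        linarith
  have b5 : μ.real {G | (n : ℝ) ^ 2 * q / 4000 ≤ ((G ⊓ T).edges.card : ℝ)} ≤ Real.exp (-d) := by
    have := binomialRandom_real_le_card_edges_inf q T (by rwa [hcard])
    rw [hcard] at this
    refine this.trans ?_
    rw [hsq, Real.exp_le_exp]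
    nlinarith
  have b6 : μ.real {G | 3 * d ≤ ((G.nbrs v₀).card : ℝ)} ≤ Real.exp (-d) := by
    have := binomialRandom_real_le_card_nbrs q v₀
    rwa [hcard, ← hdd] at this
  have b7 : μ.real {G : SimpleGraph (Fin n) | ∃ v, (G.nbrs v).card = 0} ≤
      Real.exp (2 - (d - Real.log n)) := by
    have := binomialRandom_real_exists_isolated_le q (V := Fin n) (by omega)
    rwa [hcard, ← hdd] at this
  have hsub : {G : SimpleGraph (Fin n) |
        ¬ (globalResilience (fun G' : SimpleGraph (Fin n) => G'.IsHamiltonian) G : ℤ) =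
            (@SimpleGraph.minDegree (Fin n) G _ (Classical.decRel G.Adj) : ℤ) - 1} ⊆
      {G | ¬ G.HasBoosters M k} ∪ ({G | ¬ G.LocallySparse m s} ∪
      ({G | ¬ G.LowDegreeScattered (3 * m)} ∪ ({G | ¬ (G ⊓ T).DenselyJoined s k} ∪
      ({G | (n : ℝ) ^ 2 * q / 4000 ≤ ((G ⊓ T).edges.card : ℝ)} ∪
      ({G | 3 * d ≤ ((G.nbrs v₀).card : ℝ)} ∪ {G | ∃ v, (G.nbrs v).card = 0}))))) := by
    intro G hG
    by_contra hcon
    simp only [Set.mem_union, Set.mem_ofPred_eq, not_or, not_not, not_le, not_exists] at hcon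
    obtain ⟨c1, c2, c3, c4, c5, c6, c7⟩ := hcon
    rw [hM] at c1
    have hw := ResilienceWitness.of_params (by rwa [← hdd]) (by linarith) hs4 c1 c2 c3 c4 c5
    refine hG (@ResilienceWitness.globalResilience_eq_minDegree_sub_one _ _ _ _ _
      (Classical.decRel G.Adj) _ _ _ _ hw (by omega) hm3 v₀ ?_ c7)
    have : ((G.nbrs v₀).card : ℝ) ≤ k := c6.le.trans hk1
    exact_mod_cast this
  have hle := MeasureTheory.measureReal_mono (μ := μ) hsub (MeasureTheory.measure_ne_top _ _)
  have u1 := MeasureTheory.measureReal_union_le (μ := μ) {G | ¬ G.HasBoosters M k}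
    ({G | ¬ G.LocallySparse m s} ∪
      ({G | ¬ G.LowDegreeScattered (3 * m)} ∪ ({G | ¬ (G ⊓ T).DenselyJoined s k} ∪
      ({G | (n : ℝ) ^ 2 * q / 4000 ≤ ((G ⊓ T).edges.card : ℝ)} ∪
      ({G | 3 * d ≤ ((G.nbrs v₀).card : ℝ)} ∪ {G | ∃ v, (G.nbrs v).card = 0})))))
  have u2 := MeasureTheory.measureReal_union_le (μ := μ) {G | ¬ G.LocallySparse m s}
      ({G | ¬ G.LowDegreeScattered (3 * m)} ∪ ({G | ¬ (G ⊓ T).DenselyJoined s k} ∪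
      ({G | (n : ℝ) ^ 2 * q / 4000 ≤ ((G ⊓ T).edges.card : ℝ)} ∪
      ({G | 3 * d ≤ ((G.nbrs v₀).card : ℝ)} ∪ {G | ∃ v, (G.nbrs v).card = 0}))))
  have u3 := MeasureTheory.measureReal_union_le (μ := μ) {G | ¬ G.LowDegreeScattered (3 * m)}
      ({G | ¬ (G ⊓ T).DenselyJoined s k} ∪
      ({G | (n : ℝ) ^ 2 * q / 4000 ≤ ((G ⊓ T).edges.card : ℝ)} ∪
      ({G | 3 * d ≤ ((G.nbrs v₀).card : ℝ)} ∪ {G | ∃ v, (G.nbrs v).card = 0})))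
  have u4 := MeasureTheory.measureReal_union_le (μ := μ) {G | ¬ (G ⊓ T).DenselyJoined s k}
      ({G | (n : ℝ) ^ 2 * q / 4000 ≤ ((G ⊓ T).edges.card : ℝ)} ∪
      ({G | 3 * d ≤ ((G.nbrs v₀).card : ℝ)} ∪ {G | ∃ v, (G.nbrs v).card = 0}))
  have u5 := MeasureTheory.measureReal_union_le (μ := μ)
      {G | (n : ℝ) ^ 2 * q / 4000 ≤ ((G ⊓ T).edges.card : ℝ)}
      ({G | 3 * d ≤ ((G.nbrs v₀).card : ℝ)} ∪ {G | ∃ v, (G.nbrs v).card = 0})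
  have u6 := MeasureTheory.measureReal_union_le (μ := μ)
      {G | 3 * d ≤ ((G.nbrs v₀).card : ℝ)} {G | ∃ v, (G.nbrs v).card = 0}
  rw [failureBound]
  linarith

end SimpleGraph

theorem theorem1 (p : ℕ → unitInterval)
    (hp : Tendsto (fun n : ℕ => (n : ℝ) * (p n : ℝ) - Real.log n - Real.log (Real.log n))
      atTop atTop) :
    Tendsto
      (fun n : ℕ => SimpleGraph.binomialRandom (Fin n) (p n)
        {G : SimpleGraph (Fin n) |
          (globalResilience (fun G' : SimpleGraph (Fin n) => G'.IsHamiltonian) G : ℤ) =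
            (@SimpleGraph.minDegree (Fin n) G _ (Classical.decRel G.Adj) : ℤ) - 1})
      atTop (𝓝 1) := by
  have hlog : Tendsto (fun n : ℕ => Real.log n) atTop atTop :=
    Real.tendsto_log_atTop.comp tendsto_natCast_atTop_atTop
  have hloglog : Tendsto (fun n : ℕ => Real.log (Real.log n)) atTop atTop :=
    Real.tendsto_log_atTop.comp hlog
  have hdn : Tendsto (fun n : ℕ => (n : ℝ) * (p n : ℝ) - Real.log n) atTop atTop := by
    simpa using hp.atTop_add_atTop hloglog
  have hd : Tendsto (fun n : ℕ => (n : ℝ) * (p n : ℝ)) atTop atTop := by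
    simpa using hdn.atTop_add_atTop hlog
  have hle := SimpleGraph.eventually_binomialRandom_real_le hd
    ((hdn.eventually_ge_atTop 0).mono fun n hn => by linarith)
  have h0 := squeeze_zero' (Eventually.of_forall fun n => MeasureTheory.measureReal_nonneg) hle
    (SimpleGraph.tendsto_failureBound hd hdn)
  have h1 := ENNReal.tendsto_ofReal (h0.const_sub 1)
  rw [sub_zero, ENNReal.ofReal_one] at h1
  refine h1.congr fun n => ?_
  set S : Set (SimpleGraph (Fin n)) := {G | ¬ (globalResilience
    (fun G' : SimpleGraph (Fin n) => G'.IsHamiltonian) G : ℤ) =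
      (@SimpleGraph.minDegree (Fin n) G _ (Classical.decRel G.Adj) : ℤ) - 1} with hS
  have hSc : {G : SimpleGraph (Fin n) | (globalResilience
      (fun G' : SimpleGraph (Fin n) => G'.IsHamiltonian) G : ℤ) =
        (@SimpleGraph.minDegree (Fin n) G _ (Classical.decRel G.Adj) : ℤ) - 1} = Sᶜ := by
    ext G
    simp [hS]
  have := SimpleGraph.measurableSingletonClass (V := Fin n)
  rw [hSc, ← MeasureTheory.probReal_compl_eq_one_sub (Set.toFinite S).measurableSet,
    MeasureTheory.ofReal_measureReal]
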